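/- Let $q$ be a prime power, let $\mathbb{F}_q$ be the field with $q$ elements, and let $\mathbb{F}_q((T^{-1}))$ be the field of formal Laurent series $\xi=\sum_{n\ge N}a_nT^{-n}$ over $\mathbb{F}_q$, with the absolute value $|0|=0$ and $|\xi|=q^{-N}$ if $a_N\neq 0$; write $|\cdot|$ also for its unique extension to the algebraic closure of $\mathbb{F}_q((T^{-1}))$. The height $H(P)$ of a polynomial $P\in(\mathbb{F}_q[T])[X]$ is the maximum of the absolute values of its coefficients. The degree and the height $H(\alpha)$ of an element $\alpha\in\overline{\mathbb{F}_q(T)}$ are those of its minimal polynomial over $\mathbb{F}_q[T]$ (the irreducible, primitive polynomial in $(\mathbb{F}_q[T])[X]$ with leading coefficient monic in $T$ that vanishes at $\alpha$). For $n\ge 1$ and $\xi\in\mathbb{F}_q((T^{-1}))$, let $w_n(\xi)$ (resp. $w_n^{*}(\xi)$) be the supremum, in $[-\infty,+\infty]$, of the real numbers $w$ (resp. $w^{*}$) such that $$0<|P(\xi)|\le H(P)^{-w}\qquad(\text{resp. } 0<|\xi-\alpha|\le H(\alpha)^{-w^{*}-1})$$ for infinitely many $P\in(\mathbb{F}_q[T])[X]$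 of degree at most $n$ (resp. infinitely many $\alpha\in\overline{\mathbb{F}_q(T)}$ of degree at most $n$). **Theorem.** Let $d\ge 2$ be an integer and let $w\ge \bigl(3d+2+\sqrt{9d^2+4d+4}\bigr)/2$ be a real number. Let $a,b\in\mathbb{F}_q[T]$ be distinct non-constant polynomials, and for $n\ge 1$ put $$a_{n,w}=\begin{cases} b & \text{if } n=\lfloor w^i\rfloor \text{ for some integer } i\ge 0,\\ a & \text{otherwise.}\end{cases}$$ Then the convergents of the continued fraction $[0,a_{1,w},a_{2,w},\ldots]$ converge to a unique $\xi_w\in\mathbb{F}_q((T^{-1}))$, and $$w_n^{*}(\xi_w)=w-1,\qquad w_n(\xi_w)=w\qquad\text{for all } 2\le n\le d.$$ -/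

import Mathlib

open Filter Topology Polynomial

noncomputable section

namespace LaurentApprox

variable {F : Type*} [Field F]

/-- The embedding of the polynomial ring `F[T]` into the field `F((T⁻¹))`. Elements of
`LaurentSeries F` are read as formal series `∑ aₙ T⁻ⁿ`, so that the variable `T` is sent to the
series supported at the exponent `-1`. -/
def polyEmb : F[X] →+* LaurentSeries F :=
  Polynomial.eval₂RingHom (HahnSeries.C : F →+* LaurentSeries F) (HahnSeries.single (-1 : ℤ) (1 : F))

/-- The absolute value on `F((T⁻¹))` (for a finite field `F` with `q` elements): `|0| = 0`, and
`|ξ| = q ^ (-N)` if `ξ = ∑_{n ≥ N} aₙ T⁻ⁿ` with `a_N ≠ 0`. -/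
def absL (ξ : LaurentSeries F) : ℝ :=
  open Classical in if ξ = 0 then 0 else (Nat.card F : ℝ) ^ (-ξ.order)

/-- An algebraic closure of `F((T⁻¹))`. -/
abbrev Closure (F : Type*) [Field F] : Type _ := AlgebraicClosure (LaurentSeries F)

/-- The unique extension of the absolute value to the algebraic closure, given as usual by the norm:
`|α| = |N(α)| ^ (1 / m)`, where `m` is the degree of `α` over `F((T⁻¹))` and `N` is the norm of
`F((T⁻¹))(α)`; up to sign, `N(α)` is the constant coefficient of the minimal polynomial. -/
def absC (α : Closure F) : ℝ :=
  absL ((minpoly (LaurentSeries F) α).coeff 0) ^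
    (1 / ((minpoly (LaurentSeries F) α).natDegree : ℝ))

/-- The height of a polynomial over `F[T]`: the maximum of the absolute values of its
coefficients. -/
def height (P : F[X][X]) : ℝ :=
  (Finset.range (P.natDegree + 1)).sup' Finset.nonempty_range_add_one
    fun i => absL (polyEmb (P.coeff i))

/-- `P` is the minimal polynomial over `F[T]` of `α`: it is irreducible and primitive, its leading
coefficient is a monic polynomial in `T`, and `P(α) = 0`. Such a `P` exists exactly when `α` is
algebraic over `F(T)`, and it is then unique. -/
structure IsMinPoly (P : F[X][X]) (α : Closure F) : Prop where
  irreducible : Irreducible P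
  primitive : P.IsPrimitive
  monic : P.leadingCoeff.Monic
  root : P.eval₂ ((algebraMap (LaurentSeries F) (Closure F)).comp polyEmb) α = 0

/-- The exponent `wₙ(ξ)`, in the extended reals: the supremum of the real `w` such that
`0 < |P(ξ)| ≤ H(P) ^ (-w)` for infinitely many polynomials `P` over `F[T]` of degree at
most `n`. -/
def wExp (n : ℕ) (ξ : LaurentSeries F) : EReal :=
  sSup ((fun w : ℝ => (w : EReal)) '' {w : ℝ |
    {P : F[X][X] | P.natDegree ≤ n ∧
      0 < absL (P.eval₂ polyEmb ξ) ∧ absL (P.eval₂ polyEmb ξ) ≤ height P ^ (-w)}.Infinite})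

/-- The exponent `wₙ*(ξ)`, in the extended reals: the supremum of the real `w` such that
`0 < |ξ - α| ≤ H(α) ^ (-w - 1)` for infinitely many `α` algebraic over `F(T)` of degree at most `n`.
The degree and the height of `α` are those of its minimal polynomial over `F[T]`. -/
def wStarExp (n : ℕ) (ξ : LaurentSeries F) : EReal :=
  sSup ((fun w : ℝ => (w : EReal)) '' {w : ℝ |
    {α : Closure F | ∃ P : F[X][X], IsMinPoly P α ∧ P.natDegree ≤ n ∧
      0 < absC (algebraMap (LaurentSeries F) (Closure F) ξ - α) ∧
      absC (algebraMap (LaurentSeries F) (Closure F) ξ - α) ≤ height P ^ (-w - 1)}.Infinite})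

/-- The formal continued fraction `[a₀, a₁, a₂, …]` with partial quotients in `F[T]`. -/
def contFrac (a : ℕ → F[X]) : GenContFract (LaurentSeries F) where
  h := polyEmb (a 0)
  s := Stream'.Seq.ofStream fun n => ⟨1, polyEmb (a (n + 1))⟩

/-- `ξ = [a₀, a₁, a₂, …]`: the convergents of the continued fraction tend to `ξ`. -/
def HasContFrac (a : ℕ → F[X]) (ξ : LaurentSeries F) : Prop :=
  Tendsto (fun n => absL (ξ - (contFrac a).convs n)) atTop (𝓝 0)

/-- The sequence `0, a_{1,w}, a_{2,w}, …`, where for `n ≥ 1` the entry `a_{n,w}` is `b` if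
`n = ⌊w ^ i⌋` for some integer `i ≥ 0`, and `a` otherwise. -/
def partialQuot (w : ℝ) (a b : F[X]) (n : ℕ) : F[X] :=
  open Classical in
  if n = 0 then 0 else if ∃ i : ℕ, n = ⌊w ^ i⌋₊ then b else a

end LaurentApprox

end

noncomputable section

namespace LaurentApprox

section

variable {F : Type*} [Field F]

/-! Write `N i` for the integer part of `w ^ i` and `q n` for the denominators of the convergents of
`ξ`. Keeping the partial quotients of `ξ` up to the `b` at index `N i` and continuing with `a`
forever gives a quadratic element `αᵢ`, which agrees with `ξ` up to index `N (i + 1) - 1`. Its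
minimal polynomial `Pᵢ` has height `|q (N i)|²` times a constant, its conjugate lies at distance
`|a| / H(Pᵢ)`, and `|ξ - αᵢ|` is a constant divided by `H(Pᵢ₊₁)` (`exists_isQuadPair`,
`exists_isQuadApprox`). Because `log H(Pᵢ)` is asymptotic to `2 w ^ i log |a|`, one has `H(Pᵢ₊₁) =
H(Pᵢ) ^ (w + o(1))`. So `|ξ - αᵢ|` is `H(Pᵢ) ^ (-w + o(1))`; as `|ξ - αᵢ'|` has order `1 / H(Pᵢ)`,
`|Pᵢ(ξ)| = H(Pᵢ) |ξ - αᵢ| |ξ - αᵢ'|` has the same size. This gives the lower bounds `w - 1` and `w`.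

For the upper bounds, let `Q` be irreducible of degree at most `d` and not associated to any `Pᵢ`.
The resultant of `Pᵢ` and `Q` is a nonzero element of `F[T]`, so `|Q(αᵢ)| ≥ H(Q)⁻¹ H(Pᵢ)⁻ᵈ`
(`IsQuadPair.liouville`). At the first `i` where `H(Pᵢ₊₁)` exceeds `K H(Q)² H(Pᵢ)ᵈ`, the difference
`Q(ξ) - Q(αᵢ)` is smaller than this bound, so `|Q(ξ)| = |Q(αᵢ)|`. Minimality of `i` bounds `H(Pᵢ)`
by about `H(Q) ^ (2w / (w - d))`, whence `|Q(ξ)| ≥ H(Q) ^ (-(1 + 2dw / (w - d)) - o(1))`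
(`exists_rpow_le_absV_eval₂`). The hypothesis on `w` says exactly that `1 + 2dw / (w - d) ≤ w - 1`,
so such `Q` do not beat the `Pᵢ`. Multiplicativity of the height carries the bound to reducible
polynomials (`exists_pow_mul_rpow_le`), and `|P(ξ)| ≤ H(P) |ξ - α|` carries it to algebraic elements
(`absV_eval₂_le_height_mul_absC`). -/

lemma absL_of_ne_zero {x : LaurentSeries F} (hx : x ≠ 0) :
    absL x = (Nat.card F : ℝ) ^ (-x.order) := by
  simp [absL, hx]

lemma coeff_polyEmb (f : F[X]) (m : ℤ) :
    (polyEmb f).coeff m = if m ≤ 0 then f.coeff (-m).toNat else 0 := by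
  induction f using Polynomial.induction_on' with
  | add p q hp hq => rw [map_add, HahnSeries.coeff_add, hp, hq]; split_ifs <;> simp
  | monomial n r =>
    have : polyEmb (monomial n r) = HahnSeries.single (-(n : ℤ)) r := by
      simp [polyEmb, HahnSeries.single_pow]
    rw [this, HahnSeries.coeff_single, coeff_monomial]
    split_ifs <;> first | rfl | omega

variable [Finite F]

/-! ### The absolute value on `F((T⁻¹))` -/

lemma one_lt_card_real : (1 : ℝ) < Nat.card F := by
  exact_mod_cast Finite.one_lt_card (α := F)

lemma card_real_pos : (0 : ℝ) < Nat.card F := zero_lt_one.trans one_lt_card_real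

lemma absL_add_le_max (x y : LaurentSeries F) : absL (x + y) ≤ max (absL x) (absL y) := by
  have h0 : ∀ z : LaurentSeries F, 0 ≤ absL z := fun z => by
    unfold absL; split_ifs <;> positivity
  by_cases hxy : x + y = 0
  · simp only [hxy, absL, if_true, le_max_iff]
    exact Or.inl (h0 x)
  by_cases hx : x = 0
  · simp [hx]
  by_cases hy : y = 0
  · simp [hy]
  rw [absL_of_ne_zero hxy, absL_of_ne_zero hx, absL_of_ne_zero hy]
  rcases min_le_iff.1 (HahnSeries.min_order_le_order_add hxy) with h | h
  · exact le_max_of_le_left (zpow_le_zpow_right₀ one_lt_card_real.le (neg_le_neg h))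
  · exact le_max_of_le_right (zpow_le_zpow_right₀ one_lt_card_real.le (neg_le_neg h))

variable (F) in
/-- The function `absL` as an absolute value. -/
def absV : AbsoluteValue (LaurentSeries F) ℝ where
  toFun := absL
  map_mul' x y := by
    by_cases hx : x = 0
    · simp [hx, absL]
    by_cases hy : y = 0
    · simp [hy, absL]
    rw [absL_of_ne_zero hx, absL_of_ne_zero hy, absL_of_ne_zero (mul_ne_zero hx hy),
      HahnSeries.order_mul hx hy, neg_add, zpow_add₀ card_real_pos.ne']
  nonneg' x := by unfold absL; split_ifs <;> positivity
  eq_zero' x := by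
    by_cases hx : x = 0
    · simp [hx, absL]
    · simp only [absL_of_ne_zero hx, hx, iff_false]
      exact (zpow_pos card_real_pos _).ne'
  add_le' x y := (absL_add_le_max x y).trans (max_le_add_of_nonneg
    (by unfold absL; split_ifs <;> positivity) (by unfold absL; split_ifs <;> positivity))

lemma absV_apply (x : LaurentSeries F) : absV F x = absL x := rfl

lemma absV_add_le_max (x y : LaurentSeries F) : absV F (x + y) ≤ max (absV F x) (absV F y) :=
  absL_add_le_max x y

lemma absV_sub_le_max (x y : LaurentSeries F) : absV F (x - y) ≤ max (absV F x) (absV F y) := by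
  simpa [sub_eq_add_neg, AbsoluteValue.map_neg] using absV_add_le_max x (-y)

lemma isNonarchimedean_absV : IsNonarchimedean (absV F) := absV_add_le_max

lemma absV_add_eq_of_lt {x y : LaurentSeries F} (h : absV F y < absV F x) :
    absV F (x + y) = absV F x := by
  refine le_antisymm ((absV_add_le_max x y).trans (max_le le_rfl h.le)) ?_
  by_contra! hlt
  have := absV_sub_le_max (x + y) y
  rw [add_sub_cancel_right] at this
  exact absurd this (not_le.2 (max_lt hlt h))

lemma absV_sub_eq_of_lt {x y : LaurentSeries F} (h : absV F y < absV F x) :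
    absV F (x - y) = absV F x := by
  rw [sub_eq_add_neg]
  exact absV_add_eq_of_lt (by rwa [AbsoluteValue.map_neg])

lemma absV_le_zpow_iff (x : LaurentSeries F) (n : ℤ) :
    absV F x ≤ (Nat.card F : ℝ) ^ (-n) ↔ ∀ k < n, x.coeff k = 0 := by
  by_cases hx : x = 0
  · simp only [hx, map_zero, HahnSeries.coeff_zero, implies_true, iff_true]
    exact (zpow_pos card_real_pos _).le
  · rw [absV_apply, absL_of_ne_zero hx, zpow_le_zpow_iff_right₀ one_lt_card_real, neg_le_neg_iff,
      HahnSeries.le_order_iff_forall hx]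

/-! ### Polynomials as Laurent series -/

lemma absV_polyEmb {f : F[X]} (hf : f ≠ 0) :
    absV F (polyEmb f) = (Nat.card F : ℝ) ^ f.natDegree := by
  have hc : (polyEmb f).coeff (-(f.natDegree : ℤ)) ≠ 0 := by
    simpa [coeff_polyEmb] using hf
  have hne : polyEmb f ≠ 0 := fun h => hc (by simp [h])
  have : (polyEmb f).order = -(f.natDegree : ℤ) := by
    refine le_antisymm (HahnSeries.order_le_of_coeff_ne_zero hc) ?_
    rw [HahnSeries.le_order_iff_forall hne]
    intro k hk
    rw [coeff_polyEmb, if_pos (by omega)]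
    exact coeff_eq_zero_of_natDegree_lt (by omega)
  rw [absV_apply, absL_of_ne_zero hne, this, neg_neg, zpow_natCast]

lemma polyEmb_injective : Function.Injective (polyEmb : F[X] →+* LaurentSeries F) := by
  rw [injective_iff_map_eq_zero]
  intro f hf
  by_contra h
  have := absV_polyEmb h
  rw [hf, map_zero] at this
  exact (pow_pos card_real_pos _).ne this

lemma polyEmb_eq_zero {f : F[X]} : polyEmb f = 0 ↔ f = 0 :=
  map_eq_zero_iff _ polyEmb_injective

lemma one_le_absV_polyEmb {f : F[X]} (hf : f ≠ 0) : 1 ≤ absV F (polyEmb f) := by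
  rw [absV_polyEmb hf]
  exact one_le_pow₀ one_lt_card_real.le

lemma one_lt_absV_polyEmb {f : F[X]} (hf : 0 < f.natDegree) : 1 < absV F (polyEmb f) := by
  rw [absV_polyEmb (by rintro rfl; simp at hf)]
  exact one_lt_pow₀ one_lt_card_real hf.ne'

/-! ### Heights -/

/-- Gives access to Gauss's lemma: the Gauss norm of a nonarchimedean absolute value is
multiplicative, hence so is the height. -/
lemma height_eq_gaussNorm (P : F[X][X]) : height P = (P.map polyEmb).gaussNorm (absV F) 1 := by
  apply le_antisymm
  · refine Finset.sup'_le _ _ fun i _ => ?_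
    simpa [absV_apply] using (P.map polyEmb).le_gaussNorm (absV F) zero_le_one i
  · obtain ⟨i, hi⟩ := (P.map polyEmb).exists_eq_gaussNorm (absV F) 1
    rw [hi, one_pow, mul_one, coeff_map]
    by_cases h : i ≤ P.natDegree
    · exact Finset.le_sup' (fun i => absL (polyEmb (P.coeff i))) (Finset.mem_range_succ_iff.2 h)
    · rw [coeff_eq_zero_of_natDegree_lt (not_le.1 h), map_zero, map_zero]
      exact (AbsoluteValue.nonneg (absV F) _).trans
        (Finset.le_sup' (fun i => absL (polyEmb (P.coeff i))) (Finset.mem_range_succ_iff.2 (Nat.zero_le _)))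

lemma gaussNorm_mul_absV (f g : (LaurentSeries F)[X]) :
    (f * g).gaussNorm (absV F) 1 = f.gaussNorm (absV F) 1 * g.gaussNorm (absV F) 1 :=
  gaussNorm_mul isNonarchimedean_absV zero_lt_one f g

lemma height_mul (P Q : F[X][X]) : height (P * Q) = height P * height Q := by
  rw [height_eq_gaussNorm, height_eq_gaussNorm, height_eq_gaussNorm, Polynomial.map_mul,
    gaussNorm_mul_absV]

lemma absV_coeff_le_height (P : F[X][X]) (i : ℕ) : absV F (polyEmb (P.coeff i)) ≤ height P := by
  rw [height_eq_gaussNorm]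
  simpa using (P.map polyEmb).le_gaussNorm (absV F) zero_le_one i

lemma one_le_height {P : F[X][X]} (hP : P ≠ 0) : 1 ≤ height P :=
  (one_le_absV_polyEmb (leadingCoeff_ne_zero.2 hP)).trans (absV_coeff_le_height P _)

lemma height_C (c : F[X]) : height (C c) = absV F (polyEmb c) := by
  simp [height_eq_gaussNorm]

lemma gaussNorm_add_le_max (f g : (LaurentSeries F)[X]) : (f + g).gaussNorm (absV F) 1 ≤
    max (f.gaussNorm (absV F) 1) (g.gaussNorm (absV F) 1) :=
  isNonarchimedean_gaussNorm (absV F) isNonarchimedean_absV zero_le_one f g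

lemma gaussNorm_comp_le (f : (LaurentSeries F)[X]) {g : (LaurentSeries F)[X]}
    (hg : g.gaussNorm (absV F) 1 ≤ 1) :
    (f.comp g).gaussNorm (absV F) 1 ≤ f.gaussNorm (absV F) 1 := by
  have h0 : ∀ p : (LaurentSeries F)[X], 0 ≤ p.gaussNorm (absV F) 1 :=
    fun p => p.gaussNorm_nonneg _ zero_le_one
  have hpow : ∀ n : ℕ, (g ^ n).gaussNorm (absV F) 1 ≤ 1 := by
    intro n
    induction n with
    | zero =>
      rw [pow_zero, ← C_1, gaussNorm_C, map_one]
    | succ n ih =>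
      rw [pow_succ, gaussNorm_mul_absV]
      exact mul_le_one₀ ih (h0 _) hg
  rw [comp, eval₂_eq_sum_range]
  refine Finset.sum_induction _ (fun p => p.gaussNorm (absV F) 1 ≤ f.gaussNorm (absV F) 1)
    (fun p q hp hq => (gaussNorm_add_le_max p q).trans (max_le hp hq)) ?_ fun i _ => ?_
  · simpa using h0 f
  · rw [gaussNorm_mul_absV, gaussNorm_C]
    refine (mul_le_of_le_one_right (AbsoluteValue.nonneg _ _) (hpow i)).trans ?_
    simpa using f.le_gaussNorm (absV F) zero_le_one i

lemma absV_eval_le_gaussNorm (f : (LaurentSeries F)[X]) {x : LaurentSeries F}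
    (hx : absV F x ≤ 1) : absV F (f.eval x) ≤ f.gaussNorm (absV F) 1 := by
  have := gaussNorm_comp_le f (g := C x) (by rwa [gaussNorm_C])
  rwa [comp_C, gaussNorm_C] at this

lemma absV_eval₂_le_height (P : F[X][X]) {x : LaurentSeries F} (hx : absV F x ≤ 1) :
    absV F (P.eval₂ polyEmb x) ≤ height P := by
  rw [height_eq_gaussNorm, ← eval_map]
  exact absV_eval_le_gaussNorm _ hx

/-- Divide `P - P(y)` by `X - y`: the divisor has Gauss norm at least 1, so by multiplicativity the
quotient has Gauss norm at most `H(P)`, and so has its value at `x`. -/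
lemma absV_eval₂_sub_le (P : F[X][X]) {x y : LaurentSeries F} (hx : absV F x ≤ 1)
    (hy : absV F y ≤ 1) : absV F (P.eval₂ polyEmb x - P.eval₂ polyEmb y) ≤
      height P * absV F (x - y) := by
  have h1 : 1 ≤ (X - C y).gaussNorm (absV F) 1 := by
    refine le_trans (le_of_eq ?_) ((X - C y).le_gaussNorm (absV F) zero_le_one 1)
    simp [coeff_X]
  obtain ⟨Q, hQ⟩ : X - C y ∣ P.map polyEmb - C (P.eval₂ polyEmb y) := by
    rw [dvd_iff_isRoot]; simp [eval_map]
  have hle : Q.gaussNorm (absV F) 1 ≤ height P := by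
    refine (le_mul_of_one_le_left (Q.gaussNorm_nonneg _ zero_le_one) h1).trans ?_
    rw [← gaussNorm_mul_absV, ← hQ, sub_eq_add_neg, ← C_neg]
    refine (gaussNorm_add_le_max _ _).trans (max_le (height_eq_gaussNorm P).ge ?_)
    rw [gaussNorm_C, AbsoluteValue.map_neg]
    exact absV_eval₂_le_height P hy
  have heval := congrArg (eval x) hQ
  simp only [eval_sub, eval_map, eval_C, eval_mul, eval_X] at heval
  rw [heval, map_mul, mul_comm]
  exact mul_le_mul_of_nonneg_right ((absV_eval_le_gaussNorm Q hx).trans hle)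
    (AbsoluteValue.nonneg _ _)

/-! ### The absolute value on the algebraic closure -/

lemma absC_algebraMap (x : LaurentSeries F) :
    absC (algebraMap (LaurentSeries F) (Closure F) x) = absV F x := by
  rw [absC, minpoly.eq_X_sub_C]
  simp only [coeff_sub, coeff_X_zero, coeff_C_zero, zero_sub, natDegree_X_sub_C, Nat.cast_one,
    div_one, Real.rpow_one]
  exact AbsoluteValue.map_neg (absV F) x

/-- The argument needs no multiplicativity of `absC`. The minimal polynomial `f` of `ξ - α` divides
`P(ξ - X)`, say with quotient `g`. As `f` is monic, Gauss's lemma gives `|g(0)| ≤ H(P)`, so `|P(ξ)|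
= |f(0) g(0)| ≤ H(P) |f(0)|`. If `|f(0)| ≤ 1`, then `|f(0)|` is at most its root of order `deg f`,
which is `absC`; otherwise `absC` is at least 1 and the trivial bound suffices. -/
lemma absV_eval₂_le_height_mul_absC {P : F[X][X]} {ξ : LaurentSeries F} {α : Closure F}
    (hξ : absV F ξ ≤ 1)
    (hα : P.eval₂ ((algebraMap (LaurentSeries F) (Closure F)).comp polyEmb) α = 0) :
    absV F (P.eval₂ polyEmb ξ) ≤
      height P * absC (algebraMap (LaurentSeries F) (Closure F) ξ - α) := by
  have hH : 0 ≤ height P :=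
    (AbsoluteValue.nonneg _ _).trans (absV_coeff_le_height P 0)
  set β := algebraMap (LaurentSeries F) (Closure F) ξ - α with hβ
  have hint : IsIntegral (LaurentSeries F) β := Algebra.IsIntegral.isIntegral β
  set f := minpoly (LaurentSeries F) β with hf
  have hdeg : 0 < f.natDegree := minpoly.natDegree_pos hint
  have hg : (C ξ - X).gaussNorm (absV F) 1 ≤ 1 := by
    rw [sub_eq_add_neg]
    refine (gaussNorm_add_le_max _ _).trans (max_le (by rwa [gaussNorm_C]) ?_)
    obtain ⟨i, hi⟩ := (-X : (LaurentSeries F)[X]).exists_eq_gaussNorm (absV F) 1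
    rw [hi, coeff_neg, AbsoluteValue.map_neg, coeff_X]
    split_ifs <;> simp
  obtain ⟨g, hfg⟩ : f ∣ (P.map polyEmb).comp (C ξ - X) := by
    refine minpoly.dvd _ _ ?_
    rw [aeval_def, eval₂_comp]
    simpa [hβ, eval₂_map] using hα
  have hval : P.eval₂ polyEmb ξ = f.coeff 0 * g.coeff 0 := by
    have := congrArg (eval 0) hfg
    simpa [eval_comp, eval_map, coeff_zero_eq_eval_zero] using this
  have hgle : absV F (g.coeff 0) ≤ height P := by
    have h1 : 1 ≤ f.gaussNorm (absV F) 1 := by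
      simpa [(minpoly.monic hint).leadingCoeff, hf] using f.le_gaussNorm (absV F) zero_le_one f.natDegree
    have h2 := gaussNorm_comp_le (P.map polyEmb) hg
    rw [hfg, gaussNorm_mul_absV, ← height_eq_gaussNorm] at h2
    have h3 : absV F (g.coeff 0) ≤ g.gaussNorm (absV F) 1 := by
      simpa using g.le_gaussNorm (absV F) zero_le_one 0
    exact (h3.trans (le_mul_of_one_le_left (g.gaussNorm_nonneg _ zero_le_one) h1)).trans h2
  have hC : absC β = absV F (f.coeff 0) ^ (1 / (f.natDegree : ℝ)) := rfl
  rw [hC]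
  rcases le_total 1 (absV F (f.coeff 0)) with h | h
  · refine (absV_eval₂_le_height P hξ).trans (le_mul_of_one_le_right hH ?_)
    exact Real.one_le_rpow h (by positivity)
  · rw [hval, map_mul, mul_comm]
    refine mul_le_mul hgle ?_ (AbsoluteValue.nonneg _ _) hH
    have hd1 : (1 : ℝ) ≤ f.natDegree := by exact_mod_cast hdeg
    rcases (AbsoluteValue.nonneg (absV F) (f.coeff 0)).eq_or_lt with h0 | h0
    · rw [← h0]; positivity
    · simpa using Real.rpow_le_rpow_of_exponent_ge h0 h (div_le_one_of_le₀ hd1 (by positivity))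

/-! ### Finiteness of polynomials of bounded degree and height -/

/-- Applied twice, for `F[T]` over `F` and then for polynomials over `F[T]`. -/
lemma finite_setOf_natDegree_le_coeff_mem {R : Type*} [Semiring R] (n : ℕ) {S : Set R}
    (hS : S.Finite) : {P : R[X] | P.natDegree ≤ n ∧ ∀ i, P.coeff i ∈ S}.Finite := by
  refine ((Set.Finite.pi' (fun _ : Fin (n + 1) => hS)).image
    fun c => ∑ i : Fin (n + 1), monomial (i : ℕ) (c i)).subset ?_
  rintro P ⟨hP, hc⟩
  refine ⟨fun i => P.coeff i, fun i => hc i, ?_⟩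
  simp only
  rw [Fin.sum_univ_eq_sum_range (fun i => monomial i (P.coeff i)),
    ← as_sum_range' P (n + 1) (by omega)]

lemma finite_setOf_natDegree_le_height_le (n : ℕ) (B : ℝ) :
    {P : F[X][X] | P.natDegree ≤ n ∧ height P ≤ B}.Finite := by
  obtain ⟨N, hN⟩ := pow_unbounded_of_one_lt B (one_lt_card_real (F := F))
  refine (finite_setOf_natDegree_le_coeff_mem n
    (finite_setOf_natDegree_le_coeff_mem N (Set.finite_univ (α := F)))).subset ?_
  rintro P ⟨hP, hh⟩
  refine ⟨hP, fun i => ⟨?_, fun _ => Set.mem_univ _⟩⟩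
  by_cases h : P.coeff i = 0
  · simp [h]
  · have := (absV_coeff_le_height P i).trans_lt (hh.trans_lt hN)
    rw [absV_polyEmb h] at this
    exact ((pow_lt_pow_iff_right₀ one_lt_card_real).1 this).le

end

section

/-! ### Convergents of continued fractions -/

section Convergents

variable {F : Type*} [Field F]

/-- Numerators of the convergents of `[a₀, a₁, a₂, …]`. -/
def cfNum (a : ℕ → F[X]) : ℕ → F[X]
  | 0 => a 0
  | 1 => a 1 * a 0 + 1
  | n + 2 => a (n + 2) * cfNum a (n + 1) + cfNum a n

/-- Denominators of the convergents of `[a₀, a₁, a₂, …]`. -/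
def cfDen (a : ℕ → F[X]) : ℕ → F[X]
  | 0 => 1
  | 1 => a 1
  | n + 2 => a (n + 2) * cfDen a (n + 1) + cfDen a n

lemma cfNum_add_two (a : ℕ → F[X]) (n : ℕ) :
    cfNum a (n + 2) = a (n + 2) * cfNum a (n + 1) + cfNum a n := by
  rw [cfNum]

lemma cfDen_add_two (a : ℕ → F[X]) (n : ℕ) :
    cfDen a (n + 2) = a (n + 2) * cfDen a (n + 1) + cfDen a n := by
  rw [cfDen]

lemma cfNum_mul_cfDen_sub (a : ℕ → F[X]) (n : ℕ) :
    cfNum a (n + 1) * cfDen a n - cfNum a n * cfDen a (n + 1) = (-1) ^ n := by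
  induction n with
  | zero => simp only [cfNum, cfDen]; ring
  | succ n ih =>
    rw [cfNum_add_two, cfDen_add_two, pow_succ, ← ih]
    ring

lemma cf_congr {a c : ℕ → F[X]} {M : ℕ} (h : ∀ j ≤ M, a j = c j) :
    cfNum a M = cfNum c M ∧ cfDen a M = cfDen c M := by
  induction M using Nat.strong_induction_on with
  | _ M ih =>
    match M with
    | 0 => simp [cfNum, cfDen, h 0 le_rfl]
    | 1 => simp [cfNum, cfDen, h 0 zero_le_one, h 1 le_rfl]
    | M + 2 =>
      obtain ⟨h1, h2⟩ := ih M (by omega) fun j hj => h j (by omega)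
      obtain ⟨h3, h4⟩ := ih (M + 1) (by omega) fun j hj => h j (by omega)
      simp only [cfNum, cfDen, h1, h2, h3, h4, h (M + 2) le_rfl, and_self]

lemma contFrac_nums_dens (a : ℕ → F[X]) (n : ℕ) :
    (contFrac a).nums n = polyEmb (cfNum a n) ∧ (contFrac a).dens n = polyEmb (cfDen a n) := by
  have hs : ∀ m, (contFrac a).s.get? m = some ⟨1, polyEmb (a (m + 1))⟩ := fun m => rfl
  induction n using Nat.strong_induction_on with
  | _ n ih =>
    match n with
    | 0 => simp [cfNum, cfDen, contFrac]
    | 1 =>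
      rw [GenContFract.first_num_eq (hs 0), GenContFract.first_den_eq (hs 0)]
      simp [cfNum, cfDen, contFrac]
    | n + 2 =>
      obtain ⟨h1, h2⟩ := ih n (by omega)
      obtain ⟨h3, h4⟩ := ih (n + 1) (by omega)
      rw [GenContFract.nums_recurrence (hs (n + 1)) h1 h3,
        GenContFract.dens_recurrence (hs (n + 1)) h2 h4]
      simp [cfNum, cfDen]

lemma contFrac_convs (a : ℕ → F[X]) (n : ℕ) :
    (contFrac a).convs n = polyEmb (cfNum a n) / polyEmb (cfDen a n) := by
  rw [GenContFract.conv_eq_num_div_den, (contFrac_nums_dens a n).1, (contFrac_nums_dens a n).2]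

end Convergents

/-! ### Convergence of continued fractions and exact ultrametric distances -/

variable {F : Type*} [Field F] [Finite F] {a c : ℕ → F[X]}

lemma absV_cfDen_succ (ha : ∀ n, 0 < (a (n + 1)).natDegree) (n : ℕ) :
    absV F (polyEmb (cfDen a (n + 1))) =
      absV F (polyEmb (a (n + 1))) * absV F (polyEmb (cfDen a n)) ∧
    0 < absV F (polyEmb (cfDen a n)) := by
  induction n with
  | zero => simp [cfDen]
  | succ n ih =>
    have hpos : 0 < absV F (polyEmb (cfDen a (n + 1))) := by
      rw [ih.1]
      exact mul_pos (zero_lt_one.trans (one_lt_absV_polyEmb (ha n))) ih.2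
    refine ⟨?_, hpos⟩
    rw [cfDen_add_two, map_add, absV_add_eq_of_lt, map_mul, map_mul]
    rw [map_mul, map_mul]
    refine lt_trans ?_ (lt_mul_of_one_lt_left hpos (one_lt_absV_polyEmb (ha (n + 1))))
    rw [ih.1]
    exact lt_mul_of_one_lt_left ih.2 (one_lt_absV_polyEmb (ha n))

lemma absV_cfDen_pos (ha : ∀ n, 0 < (a (n + 1)).natDegree) (n : ℕ) :
    0 < absV F (polyEmb (cfDen a n)) := (absV_cfDen_succ ha n).2

lemma polyEmb_cfDen_ne_zero (ha : ∀ n, 0 < (a (n + 1)).natDegree) (n : ℕ) :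
    polyEmb (cfDen a n) ≠ 0 := (AbsoluteValue.pos_iff _).1 (absV_cfDen_pos ha n)

lemma absV_cfDen_lt_succ (ha : ∀ n, 0 < (a (n + 1)).natDegree) (n : ℕ) :
    absV F (polyEmb (cfDen a n)) < absV F (polyEmb (cfDen a (n + 1))) := by
  rw [(absV_cfDen_succ ha n).1]
  exact lt_mul_of_one_lt_left (absV_cfDen_pos ha n) (one_lt_absV_polyEmb (ha n))

lemma card_pow_le_absV_cfDen (ha : ∀ n, 0 < (a (n + 1)).natDegree) (n : ℕ) :
    (Nat.card F : ℝ) ^ n ≤ absV F (polyEmb (cfDen a n)) := by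
  induction n with
  | zero => simp [cfDen]
  | succ n ih =>
    rw [(absV_cfDen_succ ha n).1, pow_succ', absV_polyEmb (by rintro h; simpa [h] using ha n)]
    refine mul_le_mul ?_ ih (pow_pos card_real_pos _).le (pow_pos card_real_pos _).le
    simpa using pow_le_pow_right₀ (one_lt_card_real (F := F)).le (ha n)

lemma one_le_absV_cfDen (ha : ∀ n, 0 < (a (n + 1)).natDegree) (n : ℕ) :
    1 ≤ absV F (polyEmb (cfDen a n)) :=
  (one_le_pow₀ one_lt_card_real.le).trans (card_pow_le_absV_cfDen ha n)

lemma absV_convs_succ_sub (ha : ∀ n, 0 < (a (n + 1)).natDegree) (n : ℕ) :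
    absV F ((contFrac a).convs (n + 1) - (contFrac a).convs n) =
      1 / (absV F (polyEmb (cfDen a n)) * absV F (polyEmb (cfDen a (n + 1)))) := by
  rw [contFrac_convs, contFrac_convs,
    div_sub_div _ _ (polyEmb_cfDen_ne_zero ha _) (polyEmb_cfDen_ne_zero ha _), ← map_mul, ← map_mul,
    ← map_sub, mul_comm (cfDen a (n + 1)), cfNum_mul_cfDen_sub, map_div₀, map_mul]
  simp [mul_comm]

/-- Consecutive differences have strictly decreasing absolute values, so in the telescoping sum the
first one dominates. -/
lemma absV_convs_sub (ha : ∀ n, 0 < (a (n + 1)).natDegree) (n k : ℕ) :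
    absV F ((contFrac a).convs (n + 1 + k) - (contFrac a).convs n) =
      1 / (absV F (polyEmb (cfDen a n)) * absV F (polyEmb (cfDen a (n + 1)))) := by
  induction k with
  | zero => exact absV_convs_succ_sub ha n
  | succ k ih =>
    rw [← sub_add_sub_cancel _ ((contFrac a).convs (n + 1 + k)) _, add_comm, absV_add_eq_of_lt, ih]
    rw [ih, ← add_assoc, absV_convs_succ_sub ha]
    have hm : StrictMono fun m => absV F (polyEmb (cfDen a m)) :=
      strictMono_nat_of_lt_succ (absV_cfDen_lt_succ ha)
    exact one_div_lt_one_div_of_lt (mul_pos (absV_cfDen_pos ha _) (absV_cfDen_pos ha _))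
      (mul_lt_mul'' (hm (by omega)) (hm (by omega)) (absV_cfDen_pos ha _).le
        (absV_cfDen_pos ha _).le)

lemma HasContFrac.absV_sub {ξ : LaurentSeries F} (h : HasContFrac a ξ)
    (ha : ∀ n, 0 < (a (n + 1)).natDegree) (n : ℕ) :
    absV F (ξ - (contFrac a).convs n) =
      1 / (absV F (polyEmb (cfDen a n)) * absV F (polyEmb (cfDen a (n + 1)))) := by
  have hpos : 0 < 1 / (absV F (polyEmb (cfDen a n)) * absV F (polyEmb (cfDen a (n + 1)))) :=
    one_div_pos.2 (mul_pos (absV_cfDen_pos ha _) (absV_cfDen_pos ha _))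
  obtain ⟨m, hm, hnm⟩ := ((h.eventually (gt_mem_nhds hpos)).and (eventually_ge_atTop (n + 1))).exists
  obtain ⟨k, rfl⟩ := Nat.exists_eq_add_of_le hnm
  rw [← absV_convs_sub ha n k] at hm ⊢
  rw [← sub_add_sub_cancel _ ((contFrac a).convs (n + 1 + k)) _, add_comm, absV_add_eq_of_lt hm]

lemma HasContFrac.unique {ξ η : LaurentSeries F} (h : HasContFrac a ξ) (h' : HasContFrac a η) :
    ξ = η := by
  rw [← sub_eq_zero, ← AbsoluteValue.eq_zero (absV F)]
  have hmax := h.max h'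
  rw [max_self] at hmax
  refine le_antisymm (ge_of_tendsto' hmax fun n => ?_) (AbsoluteValue.nonneg _ _)
  rw [← sub_sub_sub_cancel_right ξ η ((contFrac a).convs n)]
  exact absV_sub_le_max _ _

lemma exists_hasContFrac (ha : ∀ n, 0 < (a (n + 1)).natDegree) : ∃ ξ, HasContFrac a ξ := by
  set cv := (contFrac a).convs with hcv
  have hle : ∀ n m, n ≤ m → absV F (cv m - cv n) ≤ (Nat.card F : ℝ) ^ (-(n : ℤ)) := by
    intro n m hnm
    rcases hnm.eq_or_lt with rfl | hlt
    · simp [(pow_pos card_real_pos _).le]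
    · obtain ⟨k, rfl⟩ := Nat.exists_eq_add_of_le (Nat.succ_le_of_lt hlt)
      rw [hcv, Nat.succ_eq_add_one, absV_convs_sub ha, zpow_neg, zpow_natCast, ← one_div]
      refine one_div_le_one_div_of_le (pow_pos card_real_pos _) ?_
      exact (card_pow_le_absV_cfDen ha n).trans
        (le_mul_of_one_le_right (absV_cfDen_pos ha n).le (one_le_absV_cfDen ha _))
  have hcoeff : ∀ (k : ℤ) (n m : ℕ), k < n → k < m → (cv n).coeff k = (cv m).coeff k := by
    intro k n m hn hm
    wlog h : n ≤ m generalizing n m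
    · exact (this m n hm hn (le_of_not_ge h)).symm
    have := (absV_le_zpow_iff _ _).1 (hle n m h) k hn
    rw [HahnSeries.coeff_sub, sub_eq_zero] at this
    exact this.symm
  -- The coefficient at `k` is stable from any index exceeding `k`. For negative `k` this includes
  -- index 0, so below the order of `cv 0` all stable coefficients vanish.
  have hbdd : BddBelow (Function.support fun k : ℤ => (cv (k.toNat + 1)).coeff k) := by
    refine ⟨min 0 (cv 0).order, fun k hk => ?_⟩
    by_contra! hlt
    obtain ⟨h0, h1⟩ := lt_min_iff.1 hlt
    refine hk ?_
    simp only
    rw [hcoeff k _ 0 (by omega) (by exact_mod_cast h0)]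
    exact HahnSeries.coeff_eq_zero_of_lt_order h1
  refine ⟨HahnSeries.ofSuppBddBelow _ hbdd, ?_⟩
  have hlim : Tendsto (fun n : ℕ => (Nat.card F : ℝ) ^ (-(n : ℤ))) atTop (𝓝 0) := by
    simp only [zpow_neg, zpow_natCast]
    exact tendsto_inv_atTop_zero.comp (tendsto_pow_atTop_atTop_of_one_lt one_lt_card_real)
  refine squeeze_zero (fun n => AbsoluteValue.nonneg (absV F) _) (fun n => ?_) hlim
  refine (absV_le_zpow_iff _ _).2 fun k hk => ?_
  rw [HahnSeries.coeff_sub, HahnSeries.coeff_ofSuppBddBelow, sub_eq_zero]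
  exact hcoeff k _ _ (by omega) hk

lemma absV_le_absV_sub_mul {f g : F[X]} (hf : 0 < f.natDegree)
    (hne : f ≠ g) :
    absV F (polyEmb g) ≤ absV F (polyEmb f) * absV F (polyEmb (f - g)) := by
  have h1 : 1 ≤ absV F (polyEmb (f - g)) := one_le_absV_polyEmb (sub_ne_zero.2 hne)
  have h2 := one_lt_absV_polyEmb hf
  have := absV_sub_le_max (polyEmb f) (polyEmb (f - g))
  rw [← map_sub, sub_sub_cancel] at this
  refine this.trans (max_le ?_ ?_)
  · exact le_mul_of_one_le_right (zero_lt_one.trans h2).le h1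
  · exact le_mul_of_one_le_left (zero_lt_one.trans_le h1).le h2.le

/-- The distance between two continued fractions that first differ at the index `M + 2`. -/
lemma absV_sub_of_hasContFrac {ξ η : LaurentSeries F} (hξ : HasContFrac a ξ) (hη : HasContFrac c η)
    (ha : ∀ n, 0 < (a (n + 1)).natDegree) (hc : ∀ n, 0 < (c (n + 1)).natDegree) {M : ℕ}
    (hac : ∀ j ≤ M + 1, a j = c j) (hne : a (M + 2) ≠ c (M + 2)) :
    absV F (ξ - η) = absV F (polyEmb (a (M + 2) - c (M + 2))) /
      (absV F (polyEmb (cfDen a (M + 2))) * absV F (polyEmb (cfDen c (M + 2)))) := by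
  obtain ⟨hn1, hd1⟩ := cf_congr hac
  obtain ⟨hn0, hd0⟩ := cf_congr (M := M) fun j hj => hac j (by omega)
  have hdiff : 1 ≤ absV F (polyEmb (a (M + 2) - c (M + 2))) :=
    one_le_absV_polyEmb (sub_ne_zero.2 hne)
  have key : absV F ((contFrac a).convs (M + 2) - (contFrac c).convs (M + 2)) =
      absV F (polyEmb (a (M + 2) - c (M + 2))) /
      (absV F (polyEmb (cfDen a (M + 2))) * absV F (polyEmb (cfDen c (M + 2)))) := by
    have hid : cfNum a (M + 2) * cfDen c (M + 2) - cfDen a (M + 2) * cfNum c (M + 2) =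
        (a (M + 2) - c (M + 2)) * (-1) ^ M := by
      rw [← cfNum_mul_cfDen_sub c M, cfNum_add_two, cfNum_add_two, cfDen_add_two, cfDen_add_two,
        hn0, hd0, hn1, hd1]
      ring
    rw [contFrac_convs, contFrac_convs,
      div_sub_div _ _ (polyEmb_cfDen_ne_zero ha _) (polyEmb_cfDen_ne_zero hc _), ← map_mul,
      ← map_mul, ← map_sub, hid, map_div₀, map_mul, map_mul, map_mul]
    simp
  have hqa := absV_cfDen_pos ha
  have hqc := absV_cfDen_pos hc
  have hasucc := fun n => (absV_cfDen_succ ha n).1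
  have hcsucc := fun n => (absV_cfDen_succ hc n).1
  have hdc : absV F (polyEmb (cfDen c (M + 1))) = absV F (polyEmb (cfDen a (M + 1))) := by rw [hd1]
  -- Each series is closer to its own convergent than the two convergents are to each other. After
  -- cancelling denominators this rests on `|g| ≤ |f| |f - g|` for the two differing partial
  -- quotients.
  have h1 : absV F (ξ - (contFrac a).convs (M + 2)) <
      absV F ((contFrac a).convs (M + 2) - (contFrac c).convs (M + 2)) := by
    rw [hξ.absV_sub ha, key, div_lt_div_iff₀ (mul_pos (hqa _) (hqa _)) (mul_pos (hqa _) (hqc _)), one_mul,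
      mul_comm (absV F (polyEmb (cfDen a (M + 2)))), mul_comm (absV F (polyEmb (cfDen a (M + 2)))),
      ← mul_assoc]
    refine mul_lt_mul_of_pos_right ?_ (hqa _)
    calc _ = absV F (polyEmb (c (M + 2))) * absV F (polyEmb (cfDen a (M + 1))) := by
          rw [hcsucc (M + 1), hdc]
      _ ≤ absV F (polyEmb (a (M + 2) - c (M + 2))) * absV F (polyEmb (a (M + 2))) *
          absV F (polyEmb (cfDen a (M + 1))) := by
          refine mul_le_mul_of_nonneg_right ?_ (hqa _).le
          have h := absV_le_absV_sub_mul (ha (M + 1)) hne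
          rwa [mul_comm] at h
      _ = absV F (polyEmb (a (M + 2) - c (M + 2))) * absV F (polyEmb (cfDen a (M + 2))) := by
          rw [hasucc (M + 1), mul_assoc]
      _ < _ := mul_lt_mul_of_pos_left (absV_cfDen_lt_succ ha _) (zero_lt_one.trans_le hdiff)
  have h2 : absV F (η - (contFrac c).convs (M + 2)) <
      absV F ((contFrac a).convs (M + 2) - (contFrac c).convs (M + 2)) := by
    rw [hη.absV_sub hc, key, div_lt_div_iff₀ (mul_pos (hqc _) (hqc _)) (mul_pos (hqa _) (hqc _)), one_mul,
      mul_left_comm, mul_comm (absV F (polyEmb (cfDen a (M + 2))))]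
    refine mul_lt_mul_of_pos_left ?_ (hqc _)
    calc _ = absV F (polyEmb (a (M + 2))) * absV F (polyEmb (cfDen a (M + 1))) := hasucc (M + 1)
      _ ≤ absV F (polyEmb (a (M + 2) - c (M + 2))) * absV F (polyEmb (c (M + 2))) *
          absV F (polyEmb (cfDen a (M + 1))) := by
          refine mul_le_mul_of_nonneg_right ?_ (hqa _).le
          have h := absV_le_absV_sub_mul (hc (M + 1)) hne.symm
          rwa [mul_comm, ← neg_sub (a (M + 2)), map_neg, AbsoluteValue.map_neg] at h
      _ = absV F (polyEmb (a (M + 2) - c (M + 2))) * absV F (polyEmb (cfDen c (M + 2))) := by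
          rw [hcsucc (M + 1), hdc, mul_assoc]
      _ < _ := mul_lt_mul_of_pos_left (absV_cfDen_lt_succ hc _) (zero_lt_one.trans_le hdiff)
  have hsplit : ξ - η = ((contFrac a).convs (M + 2) - (contFrac c).convs (M + 2)) +
      ((ξ - (contFrac a).convs (M + 2)) - (η - (contFrac c).convs (M + 2))) := by ring
  rw [hsplit, absV_add_eq_of_lt ((absV_sub_le_max _ _).trans_lt (max_lt h1 h2)), key]

end

section

variable {F : Type*} [Field F] [Finite F]

/-! ### The continued fraction `[a, a, a, …]` -/

/-- `τ` is the value of `[a, a, …]`. Here numerators are shifted denominators, so `q n * (τ ^ 2 - a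
τ - 1)` is a combination of the errors `q m * τ - q (m + 1)` and stays bounded while `|q n|` tends
to infinity. -/
lemma exists_absV_eq_sq_eq {a : F[X]} (ha : 0 < a.natDegree) : ∃ τ : LaurentSeries F,
    absV F τ = absV F (polyEmb a) ∧ τ ^ 2 = polyEmb a * τ + 1 := by
  have ha' : ∀ n : ℕ, 0 < ((fun _ => a) (n + 1) : F[X]).natDegree := fun _ => ha
  obtain ⟨τ, hτ⟩ := exists_hasContFrac (a := fun _ => a) ha'
  have hnd : ∀ n, cfNum (fun _ => a) n = cfDen (fun _ => a) (n + 1) := by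
    intro n
    induction n using Nat.strong_induction_on with
    | _ n ih =>
      match n with
      | 0 => simp [cfNum, cfDen]
      | 1 => simp [cfNum, cfDen]
      | n + 2 => rw [cfNum_add_two, cfDen_add_two, ih n (by omega), ih (n + 1) (by omega)]
  have ha1 := one_lt_absV_polyEmb ha
  have h0 : absV F (τ - polyEmb a) < 1 := by
    have := hτ.absV_sub ha' 0
    rw [contFrac_convs] at this
    simp only [cfNum, cfDen, map_one, div_one, one_mul] at this
    rw [this]
    exact (div_lt_one (zero_lt_one.trans ha1)).2 ha1
  have herr : ∀ n, absV F (polyEmb (cfDen (fun _ => a) n) * τ -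
      polyEmb (cfDen (fun _ => a) (n + 1))) ≤ 1 := by
    intro n
    have h := hτ.absV_sub ha' n
    have hpos := absV_cfDen_pos (a := fun _ => a) ha' n
    rw [contFrac_convs, hnd] at h
    have : polyEmb (cfDen (fun _ => a) n) * τ - polyEmb (cfDen (fun _ => a) (n + 1)) =
        polyEmb (cfDen (fun _ => a) n) *
          (τ - polyEmb (cfDen (fun _ => a) (n + 1)) / polyEmb (cfDen (fun _ => a) n)) := by
      field_simp [polyEmb_cfDen_ne_zero (a := fun _ => a) ha' n]
    rw [this, map_mul, h, one_div, mul_inv, ← mul_assoc, mul_inv_cancel₀ hpos.ne', one_mul]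
    exact inv_le_one_of_one_le₀ (one_le_absV_cfDen (a := fun _ => a) ha' _)
  refine ⟨τ, ?_, ?_⟩
  · rw [← sub_add_cancel τ (polyEmb a), add_comm]
    exact absV_add_eq_of_lt (h0.trans ha1)
  · rw [← sub_eq_zero, ← AbsoluteValue.eq_zero (absV F)]
    refine le_antisymm (le_of_not_gt fun hpos => ?_) (AbsoluteValue.nonneg _ _)
    obtain ⟨n, hn⟩ := pow_unbounded_of_one_lt
      (1 / absV F (τ ^ 2 - (polyEmb a * τ + 1))) (one_lt_card_real (F := F))
    rw [div_lt_iff₀ hpos] at hn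
    have hid : polyEmb (cfDen (fun _ => a) n) * (τ ^ 2 - (polyEmb a * τ + 1)) =
        (τ - polyEmb a) * (polyEmb (cfDen (fun _ => a) n) * τ -
            polyEmb (cfDen (fun _ => a) (n + 1))) +
          (polyEmb (cfDen (fun _ => a) (n + 1)) * τ - polyEmb (cfDen (fun _ => a) (n + 2))) := by
      rw [cfDen_add_two, map_add, map_mul]
      ring
    have hle : absV F (polyEmb (cfDen (fun _ => a) n) * (τ ^ 2 - (polyEmb a * τ + 1))) ≤ 1 := by
      rw [hid]
      refine (absV_add_le_max _ _).trans (max_le ?_ (herr _))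
      rw [map_mul]
      exact mul_le_one₀ h0.le (AbsoluteValue.nonneg _ _) (herr n)
    rw [map_mul] at hle
    exact absurd (hn.trans_le (mul_le_mul_of_nonneg_right (card_pow_le_absV_cfDen (a := fun _ => a) ha' n)
      hpos.le)) (not_lt.2 hle)

/-- A root `τ` of `X² - aX - 1` with `|τ| = |a|` is irrational. -/
lemma eq_zero_of_add_mul_eq_zero {a : F[X]} (ha : 0 < a.natDegree) {τ : LaurentSeries F}
    (hτa : absV F τ = absV F (polyEmb a)) (hτ : τ ^ 2 = polyEmb a * τ + 1) {u v : F[X]}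
    (h : polyEmb u + polyEmb v * τ = 0) : u = 0 ∧ v = 0 := by
  have ha1 := one_lt_absV_polyEmb ha
  have hv : v = 0 := by
    induction hn : v.natDegree using Nat.strong_induction_on generalizing u v with
    | _ n ih =>
      by_contra hv
      -- Infinite descent: `t = v (τ - a)` satisfies `t τ = v`, so `-v + t τ = 0` is a relation of
      -- the same kind with `|t| = |v| / |a|`.
      set t := -u - v * a with ht
      have htτ : polyEmb t = polyEmb v * (τ - polyEmb a) := by
        rw [ht, map_sub, map_neg, map_mul]
        linear_combination -h
      have h' : polyEmb (-v) + polyEmb t * τ = 0 := by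
        rw [htτ, map_neg]
        linear_combination polyEmb v * hτ
      have ht0 : t ≠ 0 := by
        rintro h0
        rw [h0, map_zero, zero_mul, add_zero, polyEmb_eq_zero, neg_eq_zero] at h'
        exact hv h'
      have habs : absV F (polyEmb t) * absV F τ = absV F (polyEmb v) := by
        rw [← map_mul]
        congr 1
        rw [map_neg] at h'
        linear_combination h'
      refine ht0 (ih t.natDegree ?_ h' rfl)
      rw [← hn, ← pow_lt_pow_iff_right₀ (one_lt_card_real (F := F)), ← absV_polyEmb ht0,
        ← absV_polyEmb hv, ← habs, hτa]
      exact lt_mul_of_one_lt_right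
        (zero_lt_one.trans_le (one_le_absV_polyEmb ht0)) ha1
  subst hv
  rw [map_zero, zero_mul, add_zero, polyEmb_eq_zero] at h
  exact ⟨h, rfl⟩

/-- A continued fraction that ends in `a, a, a, …`. -/
lemma hasContFrac_of_eventually_const {a : F[X]} {τ : LaurentSeries F} {c : ℕ → F[X]}
    (hτa : absV F τ = absV F (polyEmb a)) (hτ : τ ^ 2 = polyEmb a * τ + 1)
    (hc : ∀ n, 0 < (c (n + 1)).natDegree) {k : ℕ} (hca : ∀ j, k + 1 < j → c j = a) :
    HasContFrac c ((polyEmb (cfNum c (k + 1)) * τ + polyEmb (cfNum c k)) /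
      (polyEmb (cfDen c (k + 1)) * τ + polyEmb (cfDen c k))) := by
  have ha1 : 1 < absV F (polyEmb a) := by
    rw [← hca (k + 2) (by omega)]; exact one_lt_absV_polyEmb (hc _)
  have hDabs : ∀ m, absV F (polyEmb (cfDen c (m + 1))) ≤
      absV F (polyEmb (cfDen c (m + 1)) * τ + polyEmb (cfDen c m)) := by
    intro m
    have h1 : absV F (polyEmb (cfDen c (m + 1))) ≤ absV F (polyEmb (cfDen c (m + 1)) * τ) := by
      rw [map_mul, hτa]
      exact le_mul_of_one_le_right (absV_cfDen_pos hc _).le ha1.le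
    rwa [absV_add_eq_of_lt ((absV_cfDen_lt_succ hc m).trans_le h1)]
  have hD : ∀ m, polyEmb (cfDen c (m + 1)) * τ + polyEmb (cfDen c m) ≠ 0 := fun m =>
    (AbsoluteValue.pos_iff _).1 ((absV_cfDen_pos hc _).trans_le (hDabs m))
  set α := (polyEmb (cfNum c (k + 1)) * τ + polyEmb (cfNum c k)) /
      (polyEmb (cfDen c (k + 1)) * τ + polyEmb (cfDen c k)) with hα
  -- Since `τ = a + 1 / τ`, the Möbius expression for `α` does not change when one more partial
  -- quotient `a` is absorbed.
  have hmob : ∀ i, α * (polyEmb (cfDen c (k + i + 1)) * τ + polyEmb (cfDen c (k + i))) =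
      polyEmb (cfNum c (k + i + 1)) * τ + polyEmb (cfNum c (k + i)) := by
    intro i
    induction i with
    | zero => exact div_mul_cancel₀ _ (hD k)
    | succ i ih =>
      rw [← add_assoc, cfDen_add_two, cfNum_add_two, hca _ (by omega), map_add, map_add, map_mul,
        map_mul]
      linear_combination τ * ih + (polyEmb (cfNum c (k + i + 1)) -
        α * polyEmb (cfDen c (k + i + 1))) * hτ
  refine squeeze_zero' (Eventually.of_forall fun n => AbsoluteValue.nonneg (absV F) _)
    (eventually_atTop.2 ⟨k + 1, fun n hn => ?_⟩)
    (tendsto_inv_atTop_zero.comp (tendsto_pow_atTop_atTop_of_one_lt (one_lt_card_real (F := F))))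
  obtain ⟨i, rfl⟩ := Nat.exists_eq_add_of_le hn
  rw [show k + 1 + i = k + i + 1 by ring]
  have hq := polyEmb_cfDen_ne_zero hc (k + i + 1)
  have hid : α - (contFrac c).convs (k + i + 1) = (-1) ^ (k + i + 1) /
      (polyEmb (cfDen c (k + i + 1)) *
        (polyEmb (cfDen c (k + i + 1)) * τ + polyEmb (cfDen c (k + i)))) := by
    have hdet := congrArg polyEmb (cfNum_mul_cfDen_sub c (k + i))
    rw [map_sub, map_mul, map_mul, map_pow, map_neg, map_one] at hdet
    rw [contFrac_convs, eq_div_iff (mul_ne_zero hq (hD _)), sub_mul, pow_succ, ← hdet,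
      mul_left_comm, hmob]
    field_simp
    ring
  change absV F _ ≤ _
  rw [hid, map_div₀, map_mul, map_pow, AbsoluteValue.map_neg, map_one, one_pow, one_div]
  refine inv_anti₀ (pow_pos card_real_pos _) ?_
  exact (card_pow_le_absV_cfDen hc _).trans (le_mul_of_one_le_right (absV_cfDen_pos hc _).le
    ((one_le_absV_cfDen hc _).trans (hDabs _)))

end

section

variable {F : Type*} [Field F] [Finite F]

/-! ### Quadratic elements of `F((T⁻¹))` -/

/-- `P` is irreducible over `F[T]` of degree two, and it splits in `F((T⁻¹))` with the roots `α` and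
`α'` in the unit ball. -/
structure IsQuadPair (P : F[X][X]) (α α' : LaurentSeries F) : Prop where
  irreducible : Irreducible P
  natDegree_eq : P.natDegree = 2
  monic : P.leadingCoeff.Monic
  map_eq : P.map polyEmb = C (polyEmb P.leadingCoeff) * ((X - C α) * (X - C α'))
  absV_le : absV F α ≤ 1
  absV_le' : absV F α' ≤ 1

lemma gaussNorm_X_sub_C {α : LaurentSeries F} (hα : absV F α ≤ 1) :
    (X - C α).gaussNorm (absV F) 1 = 1 := by
  apply le_antisymm
  · obtain ⟨i, hi⟩ := (X - C α).exists_eq_gaussNorm (absV F) 1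
    rw [hi, one_pow, mul_one, coeff_sub]
    refine (absV_sub_le_max _ _).trans (max_le ?_ ?_)
    · rw [coeff_X]; split_ifs <;> simp
    · rw [coeff_C]; split_ifs <;> simp [hα]
  · refine le_trans (le_of_eq ?_) ((X - C α).le_gaussNorm (absV F) zero_le_one 1)
    simp [coeff_X]

namespace IsQuadPair

variable {P : F[X][X]} {α α' : LaurentSeries F}

lemma isPrimitive (h : IsQuadPair P α α') : P.IsPrimitive :=
  h.irreducible.isPrimitive (by rw [h.natDegree_eq]; norm_num)

lemma height_eq (h : IsQuadPair P α α') : height P = absV F (polyEmb P.leadingCoeff) := by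
  rw [height_eq_gaussNorm, h.map_eq, gaussNorm_mul_absV, gaussNorm_mul_absV,
    gaussNorm_X_sub_C h.absV_le, gaussNorm_X_sub_C h.absV_le', gaussNorm_C, mul_one, mul_one]

lemma one_le_height (h : IsQuadPair P α α') : 1 ≤ height P :=
  LaurentApprox.one_le_height h.irreducible.ne_zero

lemma absV_eval₂ (h : IsQuadPair P α α') (ξ : LaurentSeries F) :
    absV F (P.eval₂ polyEmb ξ) = height P * (absV F (ξ - α) * absV F (ξ - α')) := by
  rw [← eval_map, h.map_eq, h.height_eq]
  simp

lemma isMinPoly (h : IsQuadPair P α α') :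
    IsMinPoly P (algebraMap (LaurentSeries F) (Closure F) α) where
  irreducible := h.irreducible
  primitive := h.isPrimitive
  monic := h.monic
  root := by
    rw [← hom_eval₂, ← eval_map, h.map_eq]
    simp

lemma eq_or_eq_of_root (h : IsQuadPair P α α') {β : Closure F}
    (hβ : P.eval₂ ((algebraMap (LaurentSeries F) (Closure F)).comp polyEmb) β = 0) :
    β = algebraMap (LaurentSeries F) (Closure F) α ∨
      β = algebraMap (LaurentSeries F) (Closure F) α' := by
  have hA : polyEmb P.leadingCoeff ≠ 0 := by
    rw [Ne, polyEmb_eq_zero, leadingCoeff_eq_zero]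
    exact h.irreducible.ne_zero
  rw [← eval₂_map, h.map_eq] at hβ
  simpa [eval₂_mul, hA, sub_eq_zero] using hβ

/-- A Liouville inequality for the values of irreducible polynomials at quadratic elements. -/
lemma liouville (h : IsQuadPair P α α') {Q : F[X][X]} (hQ : Irreducible Q)
    (hPQ : ¬ Associated P Q) {d : ℕ} (hd : Q.natDegree ≤ d) :
    1 ≤ height P ^ d * height Q * absV F (Q.eval₂ polyEmb α) := by
  have hndvd : ¬ P ∣ Q := fun hdvd => hPQ (h.irreducible.associated_of_dvd hQ hdvd)
  have hcop : IsCoprime (P.map (algebraMap F[X] (FractionRing F[X])))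
      (Q.map (algebraMap F[X] (FractionRing F[X]))) := by
    have hirr := (h.isPrimitive.irreducible_iff_irreducible_map_fraction_map
      (K := FractionRing F[X])).1 h.irreducible
    rw [hirr.coprime_iff_not_dvd]
    rwa [← h.isPrimitive.dvd_iff_fraction_map_dvd_fraction_map (FractionRing F[X])]
  have hinj := IsFractionRing.injective F[X] (FractionRing F[X])
  have hR : P.resultant Q ≠ 0 := by
    have := resultant_ne_zero _ _ hcop
    rw [natDegree_map_eq_of_injective hinj, natDegree_map_eq_of_injective hinj,
      resultant_map_map] at this
    exact fun h0 => this (by rw [h0, map_zero])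
  have hval : polyEmb (P.resultant Q) = polyEmb P.leadingCoeff ^ Q.natDegree *
      (Q.eval₂ polyEmb α * Q.eval₂ polyEmb α') := by
    have hA : polyEmb P.leadingCoeff ≠ 0 := by
      rw [Ne, polyEmb_eq_zero, leadingCoeff_eq_zero]
      exact h.irreducible.ne_zero
    have hne : (X - C α) * (X - C α') ≠ 0 := mul_ne_zero (X_sub_C_ne_zero _) (X_sub_C_ne_zero _)
    have hsplit : (P.map polyEmb).Splits := by
      rw [h.map_eq]
      exact .mul (.C _) (.mul (.X_sub_C _) (.X_sub_C _))
    have := resultant_eq_prod_eval (P.map polyEmb) (Q.map polyEmb) Q.natDegree natDegree_map_le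
      hsplit
    rw [natDegree_map_eq_of_injective polyEmb_injective, resultant_map_map] at this
    rw [this, leadingCoeff_map_of_injective polyEmb_injective, h.map_eq, roots_C_mul _ hA,
      roots_mul hne, roots_X_sub_C, roots_X_sub_C]
    simp [eval_map]
  -- A nonzero element of `F[T]` has absolute value at least 1; in the product formula for the
  -- resultant the conjugate factor is bounded trivially by `H(Q)`.
  have h1 := one_le_absV_polyEmb hR
  rw [hval, map_mul, map_mul, map_pow, ← h.height_eq] at h1
  have hH := h.one_le_height
  calc 1 ≤ _ := h1
    _ ≤ height P ^ d * (absV F (Q.eval₂ polyEmb α) * height Q) := by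
        gcongr
        exact absV_eval₂_le_height Q h.absV_le'
    _ = _ := by ring

end IsQuadPair

/-- With `α` a Möbius transform of `τ` of determinant `±1`, `A`, `B`, `D` below are the coefficients
of the norm of `(q τ + q') X - (p τ + p')`. They are divided by the leading coefficient of `A` to
make the leading coefficient monic in `T`. -/
lemma isQuadPair_of_convergents {a p p' q q' : F[X]} (ha : 0 < a.natDegree)
    {τ τ' α α' : LaurentSeries F} (hτa : absV F τ = absV F (polyEmb a))
    (hτ : τ ^ 2 = polyEmb a * τ + 1) (hτ' : τ' = polyEmb a - τ)
    (hdet : (p * q' - p' * q) ^ 2 = 1) (hA : q' ^ 2 + a * q * q' - q ^ 2 ≠ 0)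
    (hα : α * (polyEmb q * τ + polyEmb q') = polyEmb p * τ + polyEmb p')
    (hα' : α' * (polyEmb q * τ' + polyEmb q') = polyEmb p * τ' + polyEmb p')
    (h1 : absV F α ≤ 1) (h1' : absV F α' ≤ 1) :
    ∃ P : F[X][X], IsQuadPair P α α' ∧
      height P = absV F (polyEmb (q' ^ 2 + a * q * q' - q ^ 2)) := by
  set A := q' ^ 2 + a * q * q' - q ^ 2 with hAdef
  set B := 2 * p * q - a * (p * q' + p' * q) - 2 * p' * q' with hB
  set D := p' ^ 2 + a * p * p' - p ^ 2 with hD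
  set u := A.leadingCoeff⁻¹ with hu
  have hu0 : u ≠ 0 := inv_ne_zero (leadingCoeff_ne_zero.2 hA)
  have hCu : IsUnit (C u) := isUnit_C.2 hu0.isUnit
  set P : F[X][X] := C (C u * A) * X ^ 2 + C (C u * B) * X + C (C u * D) with hP
  have huA : C u * A ≠ 0 := mul_ne_zero hCu.ne_zero hA
  have hdeg : P.natDegree = 2 := natDegree_quadratic huA
  have hlc : P.leadingCoeff = C u * A := leadingCoeff_quadratic huA
  have hmon : P.leadingCoeff.Monic := by
    rw [hlc, Monic, leadingCoeff_mul, leadingCoeff_C, hu]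
    exact inv_mul_cancel₀ (leadingCoeff_ne_zero.2 hA)
  have hAe : (polyEmb q * τ + polyEmb q') * (polyEmb q * τ' + polyEmb q') = polyEmb A := by
    rw [hAdef, hτ']
    simp only [map_add, map_sub, map_mul, map_pow]
    linear_combination -polyEmb q ^ 2 * hτ
  have hAe0 : polyEmb A ≠ 0 := by rwa [Ne, polyEmb_eq_zero]
  have hB' : polyEmb B = -polyEmb A * (α + α') := by
    have : polyEmb A * (α + α') = (polyEmb p * τ + polyEmb p') * (polyEmb q * τ' + polyEmb q') +
        (polyEmb p * τ' + polyEmb p') * (polyEmb q * τ + polyEmb q') := by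
      rw [← hAe, ← hα, ← hα']; ring
    rw [neg_mul, this, hB, hτ']
    simp only [map_add, map_sub, map_mul, map_ofNat]
    linear_combination -2 * polyEmb p * polyEmb q * hτ
  have hD' : polyEmb D = polyEmb A * (α * α') := by
    have : polyEmb A * (α * α') =
        (polyEmb p * τ + polyEmb p') * (polyEmb p * τ' + polyEmb p') := by
      rw [← hAe, ← hα, ← hα']; ring
    rw [this, hD, hτ']
    simp only [map_add, map_sub, map_mul, map_pow]
    linear_combination polyEmb p ^ 2 * hτ
  have hmap : P.map polyEmb = C (polyEmb P.leadingCoeff) * ((X - C α) * (X - C α')) := by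
    rw [hlc, hP]
    simp only [Polynomial.map_add, Polynomial.map_mul, Polynomial.map_pow, map_C, map_X, map_mul,
      hB', hD', map_add, map_neg]
    ring
  have hprim : P.IsPrimitive := by
    intro r hr
    rw [C_dvd_iff_dvd_coeff] at hr
    have h2 := hr 2
    have h1 := hr 1
    have h0 := hr 0
    simp only [hP, coeff_add, coeff_C_mul, coeff_X_pow, coeff_X, coeff_C] at h0 h1 h2
    norm_num at h0 h1 h2
    -- The binary form attached to `A`, `B`, `D` takes at `(p, q)` the square of the determinant, so
    -- a common divisor of the coefficients is a unit.
    have hcomb : A * p ^ 2 + B * (p * q) + D * q ^ 2 = 1 := by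
      rw [← hdet, hAdef, hB, hD]; ring
    refine isUnit_of_dvd_unit ?_ hCu
    have : C u = C u * A * p ^ 2 + C u * B * (p * q) + C u * D * q ^ 2 := by
      linear_combination -(C u) * hcomb
    rw [this]
    exact dvd_add (dvd_add (h2.mul_right _) (h1.mul_right _)) (h0.mul_right _)
  -- Neither root is rational: a linear relation for it pulls back to one for `τ`, which is
  -- irrational, and the matrix of convergents is invertible.
  have hirr_aux : ∀ s t : F[X], ∀ β : LaurentSeries F, β = α ∨ β = α' →
      polyEmb s * β + polyEmb t = 0 → s = 0 := by
    intro s t β hβ hst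
    have hlin : s * p + t * q = 0 ∧ s * p' + t * q' = 0 := by
      rcases hβ with rfl | rfl
      · refine (eq_zero_of_add_mul_eq_zero ha hτa hτ (u := s * p' + t * q') (v := s * p + t * q)
          ?_).symm
        simp only [map_add, map_mul]
        linear_combination (polyEmb q * τ + polyEmb q') * hst - polyEmb s * hα
      · have h := eq_zero_of_add_mul_eq_zero ha hτa hτ
          (u := s * p' + t * q' + a * (s * p + t * q)) (v := -(s * p + t * q)) (by
            simp only [map_add, map_mul, map_neg]
            rw [hτ'] at hα'
            linear_combination (polyEmb q * (polyEmb a - τ) + polyEmb q') * hst - polyEmb s * hα')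
        have h2 : s * p + t * q = 0 := neg_eq_zero.1 h.2
        refine ⟨h2, ?_⟩
        have := h.1
        rwa [h2, mul_zero, add_zero] at this
    have hs : s * (p * q' - p' * q) = 0 := by
      linear_combination q' * hlin.1 - q * hlin.2
    rcases mul_eq_zero.1 hs with h0 | h0
    · exact h0
    · rw [h0] at hdet; simp at hdet
  have hirr : Irreducible P := by
    refine ⟨fun hunit => ?_, fun f g hfg => ?_⟩
    · have := natDegree_eq_zero_of_isUnit hunit
      omega
    · have hP0 : P ≠ 0 := by rintro h0; simp [h0] at hdeg
      have hf0 : f ≠ 0 := by rintro rfl; simp at hfg; exact hP0 hfg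
      have hg0 : g ≠ 0 := by rintro rfl; simp at hfg; exact hP0 hfg
      have hsum : f.natDegree + g.natDegree = 2 := by
        rw [← natDegree_mul hf0 hg0, ← hfg, hdeg]
      have hconst : ∀ f : F[X][X], f ∣ P → f.natDegree = 0 → IsUnit f := by
        intro f hfd hf
        rw [eq_C_of_natDegree_eq_zero hf] at hfd ⊢
        exact isUnit_C.2 (hprim _ hfd)
      have hnot1 : f.natDegree ≠ 1 := by
        intro hf1
        have hs : f.coeff 1 ≠ 0 := by
          rw [← hf1]; exact leadingCoeff_ne_zero.2 hf0
        have hse : polyEmb (f.coeff 1) ≠ 0 := by rwa [Ne, polyEmb_eq_zero]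
        set β := -polyEmb (f.coeff 0) / polyEmb (f.coeff 1) with hβ
        have hfβ : polyEmb (f.coeff 1) * β + polyEmb (f.coeff 0) = 0 := by
          rw [hβ, mul_div_cancel₀ _ hse, neg_add_cancel]
        have hroot : (P.map polyEmb).eval β = 0 := by
          have hfe : (f.map polyEmb).eval β = 0 := by
            rw [eval_map, eval₂_eq_sum_range, hf1, Finset.sum_range_succ, Finset.sum_range_one,
              ← hfβ]
            ring
          rw [hfg, Polynomial.map_mul, eval_mul, hfe, zero_mul]
        rw [hmap, hlc] at hroot
        have hβα : β = α ∨ β = α' := by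
          have : polyEmb (C u * A) ≠ 0 := by rwa [Ne, polyEmb_eq_zero]
          simpa only [eval_mul, eval_C, eval_sub, eval_X, mul_eq_zero, this, false_or,
            sub_eq_zero] using hroot
        exact hs (hirr_aux _ _ β hβα hfβ)
      rcases (by omega : f.natDegree = 0 ∨ g.natDegree = 0) with h0 | h0
      · exact Or.inl (hconst f ⟨g, hfg⟩ h0)
      · exact Or.inr (hconst g ⟨f, by rw [hfg, mul_comm]⟩ h0)
  have hpair : IsQuadPair P α α' := ⟨hirr, hdeg, hmon, hmap, h1, h1'⟩
  refine ⟨P, hpair, ?_⟩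
  rw [hpair.height_eq, hlc, map_mul, map_mul, absV_polyEmb hCu.ne_zero, natDegree_C, pow_zero,
    one_mul]

end

/-! ### Quadratic elements close to a given continued fraction -/

section

variable {F : Type*} [Field F] [Finite F]

lemma HasContFrac.absV_le_one {s : ℕ → F[X]} {ξ : LaurentSeries F} (hξ : HasContFrac s ξ)
    (h0 : s 0 = 0) (hs : ∀ n, 0 < (s (n + 1)).natDegree) : absV F ξ ≤ 1 := by
  have := hξ.absV_sub hs 0
  rw [contFrac_convs] at this
  simp only [cfNum, cfDen, h0, map_zero, zero_div, sub_zero, map_one, one_mul] at this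
  rw [this]
  exact div_le_one_of_le₀ (one_lt_absV_polyEmb (hs 0)).le (AbsoluteValue.nonneg _ _)

/-- Factor as `q (a q' - q) + q'²`. By the recurrence, `a q' - q` is `(a - s (k + 1)) q'` up to a
term smaller than `q'`, and `s (k + 1) ≠ a` makes the main term dominate. This computes the leading
coefficient, hence the height, of the quadratic polynomial. -/
lemma absV_norm_form {a : F[X]} {s : ℕ → F[X]} (hs : ∀ n, 0 < (s (n + 1)).natDegree) {k : ℕ}
    (hk : s (k + 1) ≠ a) :
    absV F (polyEmb (cfDen s k ^ 2 + a * cfDen s (k + 1) * cfDen s k - cfDen s (k + 1) ^ 2)) =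
      absV F (polyEmb (cfDen s (k + 1))) * absV F (polyEmb (cfDen s k)) *
        absV F (polyEmb (a - s (k + 1))) := by
  have hq' := absV_cfDen_pos hs k
  have hq := absV_cfDen_pos hs (k + 1)
  have hlt := absV_cfDen_lt_succ hs k
  have h1 : 1 ≤ absV F (polyEmb (a - s (k + 1))) := one_le_absV_polyEmb (sub_ne_zero.2 hk.symm)
  have hr : absV F (polyEmb (s (k + 1) * cfDen s k - cfDen s (k + 1))) <
      absV F (polyEmb (cfDen s k)) := by
    match k with
    | 0 => simp [cfDen]
    | k + 1 =>
      rw [cfDen_add_two, sub_add_cancel_left, map_neg, AbsoluteValue.map_neg]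
      exact absV_cfDen_lt_succ hs k
  have hmid : absV F (polyEmb (a * cfDen s k - cfDen s (k + 1))) =
      absV F (polyEmb (cfDen s k)) * absV F (polyEmb (a - s (k + 1))) := by
    have : a * cfDen s k - cfDen s (k + 1) =
        cfDen s k * (a - s (k + 1)) + (s (k + 1) * cfDen s k - cfDen s (k + 1)) := by ring
    rw [this, map_add, absV_add_eq_of_lt, map_mul, map_mul]
    rw [map_mul, map_mul]
    exact hr.trans_le (le_mul_of_one_le_right hq'.le h1)
  have : cfDen s k ^ 2 + a * cfDen s (k + 1) * cfDen s k - cfDen s (k + 1) ^ 2 =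
      cfDen s (k + 1) * (a * cfDen s k - cfDen s (k + 1)) + cfDen s k * cfDen s k := by ring
  rw [this, map_add, absV_add_eq_of_lt, map_mul, map_mul, hmid, mul_assoc]
  rw [map_mul, map_mul, map_mul, map_mul, hmid]
  exact (mul_lt_mul_of_pos_right hlt hq').trans_le
    (mul_le_mul_of_nonneg_left (le_mul_of_one_le_right hq'.le h1) hq.le)

/-- If the partial quotients of `ξ` are equal to `a` between the indices `k + 1` and `M + 2`, then
`ξ` is close to a quadratic element. -/
lemma exists_isQuadPair {a : F[X]} (ha : 0 < a.natDegree) {s : ℕ → F[X]} (h0 : s 0 = 0)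
    (hs : ∀ n, 0 < (s (n + 1)).natDegree) {ξ : LaurentSeries F} (hξ : HasContFrac s ξ) {k M : ℕ}
    (hkM : k ≤ M) (hk : s (k + 1) ≠ a) (hM : s (M + 2) ≠ a)
    (hconst : ∀ j, k + 1 < j → j < M + 2 → s j = a) :
    ∃ (P : F[X][X]) (α α' : LaurentSeries F), IsQuadPair P α α' ∧
      height P * absV F (polyEmb (s (k + 1))) =
        absV F (polyEmb (cfDen s (k + 1))) ^ 2 * absV F (polyEmb (a - s (k + 1))) ∧
      absV F (α - α') * height P = absV F (polyEmb a) ∧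
      absV F (ξ - α) * (absV F (polyEmb a) * absV F (polyEmb (cfDen s (M + 2))) ^ 2) =
        absV F (polyEmb (a - s (M + 2))) * absV F (polyEmb (s (M + 2))) := by
  obtain ⟨τ, hτa, hτ⟩ := exists_absV_eq_sq_eq ha
  have ha1 := one_lt_absV_polyEmb ha
  -- The expansion of `α`: it agrees with `s` through index `M + 1` and first differs at `M + 2`.
  set c : ℕ → F[X] := fun j => if j ≤ k + 1 then s j else a with hc
  have hcs : ∀ j ≤ M + 1, s j = c j := by
    intro j hj
    simp only [hc]
    split_ifs with h
    · rfl
    · exact hconst j (by omega) (by omega)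
  have hcdeg : ∀ n, 0 < (c (n + 1)).natDegree := by
    intro n
    simp only [hc]
    split_ifs
    · exact hs n
    · exact ha
  have hca : ∀ j, k + 1 < j → c j = a := fun j hj => if_neg (by omega)
  have hα := hasContFrac_of_eventually_const hτa hτ hcdeg hca
  obtain ⟨hn1, hd1⟩ := cf_congr (M := k + 1) fun j hj => hcs j (by omega)
  obtain ⟨hn0, hd0⟩ := cf_congr (M := k) fun j hj => hcs j (by omega)
  rw [← hn1, ← hn0, ← hd1, ← hd0] at hα
  have hnorm := absV_norm_form (a := a) hs hk
  have hdet := cfNum_mul_cfDen_sub s k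
  set p := cfNum s (k + 1)
  set p' := cfNum s k
  set q := cfDen s (k + 1) with hq
  set q' := cfDen s k with hq'
  have hqpos : 0 < absV F (polyEmb q) := absV_cfDen_pos hs _
  have hqpos' : 0 < absV F (polyEmb q') := absV_cfDen_pos hs _
  have hdiff : 1 ≤ absV F (polyEmb (a - s (k + 1))) := one_le_absV_polyEmb (sub_ne_zero.2 hk.symm)
  set A := q' ^ 2 + a * q * q' - q ^ 2 with hA
  have hApos : 0 < absV F (polyEmb A) := by
    rw [hnorm]
    exact mul_pos (mul_pos hqpos hqpos') (zero_lt_one.trans_le hdiff)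
  have hA0 : A ≠ 0 := by rintro h; simp [h] at hApos
  set τ' := polyEmb a - τ with hτ'
  have hAe : (polyEmb q * τ + polyEmb q') * (polyEmb q * τ' + polyEmb q') = polyEmb A := by
    rw [hA, hτ']
    simp only [map_add, map_sub, map_mul, map_pow]
    linear_combination -polyEmb q ^ 2 * hτ
  have hAe0 : polyEmb A ≠ 0 := by rwa [Ne, polyEmb_eq_zero]
  have hD0 : polyEmb q * τ + polyEmb q' ≠ 0 := fun h => hAe0 (by rw [← hAe, h, zero_mul])
  have hD0' : polyEmb q * τ' + polyEmb q' ≠ 0 := fun h => hAe0 (by rw [← hAe, h, mul_zero])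
  set α := (polyEmb p * τ + polyEmb p') / (polyEmb q * τ + polyEmb q') with hαdef
  set α' := (polyEmb p * τ' + polyEmb p') / (polyEmb q * τ' + polyEmb q') with hαdef'
  have hττ' : absV F (τ - τ') = absV F (polyEmb a) := by
    rw [← hτa]
    refine absV_sub_eq_of_lt ?_
    have h1 : absV F τ * absV F τ' = 1 := by
      rw [← map_mul, show τ * τ' = -1 by rw [hτ']; linear_combination -hτ, AbsoluteValue.map_neg,
        map_one]
    rw [← hτa] at ha1
    refine lt_trans ?_ ha1
    by_contra! h
    exact absurd h1 (ne_of_gt (one_lt_mul_of_lt_of_le ha1 h))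
  have hsub : (α - α') * polyEmb A = (-1) ^ k * (τ - τ') := by
    have hdet' := congrArg polyEmb hdet
    rw [map_sub, map_mul, map_mul, map_pow, map_neg, map_one] at hdet'
    rw [← hdet', ← hAe, hαdef, hαdef', div_sub_div _ _ hD0 hD0', div_mul_cancel₀ _
      (mul_ne_zero hD0 hD0')]
    ring
  have hsubA : absV F (α - α') * absV F (polyEmb A) = absV F (polyEmb a) := by
    rw [← map_mul, hsub, map_mul, hττ', map_pow, AbsoluteValue.map_neg, map_one, one_pow, one_mul]
  have hα1 : absV F α ≤ 1 := hα.absV_le_one (by simp [hc, h0]) hcdeg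
  -- It suffices that `|α - α'| ≤ 1`, that is `|a| ≤ |A|`, which follows from the value of the norm
  -- form.
  have hα1' : absV F α' ≤ 1 := by
    rw [← sub_sub_cancel α α']
    refine (absV_sub_le_max _ _).trans (max_le hα1 ?_)
    refine le_of_mul_le_mul_right ?_ hApos
    rw [hsubA, one_mul, hnorm, hq, (absV_cfDen_succ hs k).1]
    have h1 := absV_le_absV_sub_mul (hs k) hk
    rw [← neg_sub, map_neg, AbsoluteValue.map_neg] at h1
    refine h1.trans (mul_le_mul_of_nonneg_right ?_ (AbsoluteValue.nonneg _ _))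
    rw [mul_assoc]
    exact le_mul_of_one_le_right (AbsoluteValue.nonneg _ _)
      (one_le_mul_of_one_le_of_one_le (one_le_absV_cfDen hs k) (one_le_absV_cfDen hs k))
  obtain ⟨P, hP, hheight⟩ := isQuadPair_of_convergents ha hτa hτ hτ'
    (by rw [hdet, ← pow_mul, mul_comm, pow_mul, neg_one_sq, one_pow]) hA0
    (div_mul_cancel₀ _ hD0) (div_mul_cancel₀ _ hD0') hα1 hα1'
  refine ⟨P, α, α', hP, ?_, ?_, ?_⟩
  · rw [hheight, hnorm, hq, (absV_cfDen_succ hs k).1]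
    ring
  · rw [hheight, hsubA]
  · have hcM : c (M + 2) = a := hca _ (by omega)
    have hdist := absV_sub_of_hasContFrac hξ hα hs hcdeg hcs (by rwa [hcM])
    rw [hcM, ← neg_sub a (s (M + 2)), map_neg, AbsoluteValue.map_neg, (absV_cfDen_succ hs (M + 1)).1,
      (absV_cfDen_succ hcdeg (M + 1)).1, hcM, ← (cf_congr hcs).2] at hdist
    rw [hdist, (absV_cfDen_succ hs (M + 1)).1]
    have h2 := (absV_cfDen_pos hs (M + 1)).ne'
    have h3 := (zero_lt_one.trans (one_lt_absV_polyEmb (hs (M + 1)))).ne'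
    have h4 := (zero_lt_one.trans ha1).ne'
    field_simp

end

section

variable {F : Type*} [Field F] [Finite F]

/-! ### Exponents of series with a dense sequence of quadratic approximations -/

lemma rpow_neg_le_iff {H V θ : ℝ} (hH : 0 < H) (hV : 0 < V) :
    H ^ (-θ) ≤ V ↔ -Real.log V ≤ θ * Real.log H := by
  rw [← Real.log_le_log_iff (Real.rpow_pos_of_pos hH _) hV, Real.log_rpow hH]
  constructor <;> intro h <;> linarith

lemma le_rpow_neg_iff {H V θ : ℝ} (hH : 0 < H) (hV : 0 < V) :
    V ≤ H ^ (-θ) ↔ θ * Real.log H ≤ -Real.log V := by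
  rw [← Real.log_le_log_iff hV (Real.rpow_pos_of_pos hH _), Real.log_rpow hH]
  constructor <;> intro h <;> linarith

/-- Turns "for all large `i`" into "for all `Pᵢ` of large height", the form suited to statements
that quantify over polynomials. -/
lemma exists_bound_of_eventually {f : ℕ → ℝ} {p : ℕ → Prop} (h : ∀ᶠ i in atTop, p i) :
    ∃ B, ∀ i, B ≤ f i → p i := by
  obtain ⟨N, hN⟩ := eventually_atTop.1 h
  obtain ⟨B, hB⟩ := ((Set.finite_lt_nat N).image f).bddAbove
  refine ⟨B + 1, fun i hi => hN i ?_⟩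
  by_contra! hlt
  have := hB ⟨i, hlt, rfl⟩
  linarith

/-- The quadratic elements `αᵢ`, with minimal polynomials `Pᵢ` and conjugates `αᵢ'`, approximate `ξ`
to a precision given by the height of the next polynomial, and the heights grow like
`H(Pᵢ₊₁) = H(Pᵢ) ^ (w + o(1))`. -/
structure IsQuadApprox (w : ℝ) (ξ : LaurentSeries F) (P : ℕ → F[X][X]) (α α' : ℕ → LaurentSeries F)
    (K K' : ℝ) : Prop where
  absV_le : absV F ξ ≤ 1
  one_lt : 1 < w
  pair : ∀ i, IsQuadPair (P i) (α i) (α' i)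
  pos : 0 < K
  pos' : 0 < K'
  dist : ∀ i, absV F (ξ - α i) * height (P (i + 1)) = K
  dist' : ∀ i, absV F (α i - α' i) * height (P i) = K'
  tendsto_log : Tendsto (fun i => Real.log (height (P i))) atTop atTop
  tendsto_ratio : Tendsto (fun i => Real.log (height (P (i + 1))) / Real.log (height (P i))) atTop
    (𝓝 w)

namespace IsQuadApprox

variable {w : ℝ} {ξ : LaurentSeries F} {P : ℕ → F[X][X]} {α α' : ℕ → LaurentSeries F} {K K' : ℝ}

lemma height_pos (h : IsQuadApprox w ξ P α α' K K') (i : ℕ) : 0 < height (P i) :=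
  zero_lt_one.trans_le (h.pair i).one_le_height

lemma tendsto_add_ratio (h : IsQuadApprox w ξ P α α' K K') (k : ℝ) :
    Tendsto (fun i => (Real.log (height (P (i + 1))) + k) / Real.log (height (P i))) atTop
      (𝓝 w) := by
  simp only [add_div]
  simpa using h.tendsto_ratio.add (h.tendsto_log.const_div_atTop k)

lemma eventually_add_le (h : IsQuadApprox w ξ P α α' K K') {θ : ℝ} (hθ : w < θ) (k : ℝ) :
    ∀ᶠ i in atTop, Real.log (height (P (i + 1))) + k ≤ θ * Real.log (height (P i)) := by
  filter_upwards [(h.tendsto_add_ratio k).eventually (gt_mem_nhds hθ),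
    h.tendsto_log.eventually_gt_atTop 0] with i hi hpos
  exact ((div_lt_iff₀ hpos).1 hi).le

lemma eventually_le_add (h : IsQuadApprox w ξ P α α' K K') {θ : ℝ} (hθ : θ < w) (k : ℝ) :
    ∀ᶠ i in atTop, θ * Real.log (height (P i)) ≤ Real.log (height (P (i + 1))) + k := by
  filter_upwards [(h.tendsto_add_ratio k).eventually (lt_mem_nhds hθ),
    h.tendsto_log.eventually_gt_atTop 0] with i hi hpos
  exact ((lt_div_iff₀ hpos).1 hi).le

lemma log_absV_sub (h : IsQuadApprox w ξ P α α' K K') (i : ℕ) :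
    0 < absV F (ξ - α i) ∧
      Real.log (absV F (ξ - α i)) = Real.log K - Real.log (height (P (i + 1))) := by
  have h1 := h.height_pos (i + 1)
  have h2 : 0 < absV F (ξ - α i) := pos_of_mul_pos_left (by rw [h.dist]; exact h.pos) h1.le
  refine ⟨h2, ?_⟩
  rw [← h.dist i, Real.log_mul h2.ne' h1.ne']
  ring

/-- Eventually `ξ` is much closer to `αᵢ` than `αᵢ'` is, because `w > 1`; so `|ξ - αᵢ'| = |αᵢ -
αᵢ'|`. -/
lemma eventually_absV_sub' (h : IsQuadApprox w ξ P α α' K K') :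
    ∀ᶠ i in atTop, absV F (ξ - α' i) * height (P i) = K' := by
  filter_upwards [h.eventually_le_add h.one_lt (Real.log K' - Real.log K - 1)] with i hi
  have h0 := h.height_pos i
  have h1 := h.height_pos (i + 1)
  rw [← sub_add_sub_cancel ξ (α i), add_comm, absV_add_eq_of_lt, h.dist']
  rw [← mul_lt_mul_iff_left₀ h0, h.dist']
  have h2 := (h.log_absV_sub i).1
  rw [← Real.log_lt_log_iff (mul_pos h2 h0) h.pos', Real.log_mul h2.ne' h0.ne',
    (h.log_absV_sub i).2]
  linarith

lemma eventually_absV_eval₂ (h : IsQuadApprox w ξ P α α' K K') :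
    ∀ᶠ i in atTop, 0 < absV F ((P i).eval₂ polyEmb ξ) ∧
      Real.log (absV F ((P i).eval₂ polyEmb ξ)) =
        Real.log K + Real.log K' - Real.log (height (P (i + 1))) := by
  filter_upwards [h.eventually_absV_sub'] with i hi
  have h2 := (h.log_absV_sub i).1
  have : absV F ((P i).eval₂ polyEmb ξ) = absV F (ξ - α i) * K' := by
    rw [(h.pair i).absV_eval₂, ← hi]; ring
  rw [this]
  refine ⟨mul_pos h2 h.pos', ?_⟩
  rw [Real.log_mul h2.ne' h.pos'.ne', (h.log_absV_sub i).2]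
  ring

/-- The values at `ξ` of the irreducible polynomials other than the `Pᵢ` are not small. -/
lemma exists_rpow_le_absV_eval₂ (h : IsQuadApprox w ξ P α α' K K') {d : ℕ} (hdw : (d : ℝ) < w)
    (hd : 1 + 2 * d * w / (w - d) ≤ w - 1) {θ : ℝ} (hθ : w - 1 < θ) :
    ∃ B, ∀ Q : F[X][X], Irreducible Q → Q.natDegree ≤ d → (∀ i, ¬ Associated (P i) Q) →
      B ≤ height Q → height Q ^ (-θ) ≤ absV F (Q.eval₂ polyEmb ξ) := by
  -- `δ` absorbs the `o(1)` in `H(Pᵢ₊₁) = H(Pᵢ) ^ (w + o(1))`; by continuity the resulting exponent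
  -- still lies below `θ`.
  obtain ⟨δ, hδ0, hδ1, hδ2⟩ : ∃ δ : ℝ, 0 < δ ∧ δ < w - d ∧
      1 + 2 * d * (w + δ) / (w - d - δ) < θ := by
    have hcont : ContinuousAt (fun δ : ℝ => 1 + 2 * d * (w + δ) / (w - d - δ)) 0 := by
      refine continuousAt_const.add (ContinuousAt.div (by fun_prop) (by fun_prop) ?_)
      exact (show (0 : ℝ) < w - d - 0 by linarith).ne'
    have h0 : 1 + 2 * d * (w + 0) / (w - d - 0) < θ := by
      rw [add_zero, sub_zero]
      linarith
    have h1 := hcont.eventually (gt_mem_nhds h0)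
    have h2 : ∀ᶠ δ : ℝ in 𝓝 0, δ < w - d := gt_mem_nhds (by linarith)
    obtain ⟨δ, ⟨h3, h4⟩, h5⟩ := (((h1.and h2).filter_mono nhdsWithin_le_nhds).and
      (self_mem_nhdsWithin (a := (0 : ℝ)) (s := Set.Ioi 0))).exists
    exact ⟨δ, h5, h4, h3⟩
  obtain ⟨N, hN⟩ := eventually_atTop.1 ((h.eventually_add_le (θ := w + δ) (by linarith) 0).and
    (h.eventually_le_add (θ := w - δ) (by linarith) 0))
  have hwd : 0 < w - d - δ := by linarith
  set γ := θ - (1 + 2 * d * (w + δ) / (w - d - δ)) with hγ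
  have hγ0 : 0 < γ := by linarith
  set k := d * (w + δ) / (w - d - δ) * |Real.log K| with hk
  obtain ⟨B₁, hB₁⟩ := ((Set.finite_le_nat N).image
    fun i => Real.log (height (P (i + 1)))).bddAbove
  -- The first entry lets the spare exponent `γ` absorb the constant `k`; the second excludes
  -- indices up to `N` from the choice of `i` below.
  set b := max (max 0 (k / γ)) (max (B₁ - Real.log K) 0) with hb
  refine ⟨Real.exp b, fun Q hQ hQd hQP hBQ => ?_⟩
  have hHQ : 1 ≤ height Q := one_le_height hQ.ne_zero
  have hHQ0 : 0 < height Q := zero_lt_one.trans_le hHQ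
  have hlog : b ≤ Real.log (height Q) := (Real.le_log_iff_exp_le hHQ0).2 hBQ
  have hlogP : ∀ i, 0 ≤ Real.log (height (P i)) := fun i => Real.log_nonneg (h.pair i).one_le_height
  -- In multiplicative form, `K H(Q)² H(Pᵢ)ᵈ < H(Pᵢ₊₁)`: the condition under which `|Q(ξ) - Q(αᵢ)|`
  -- falls below the Liouville bound for `|Q(αᵢ)|`. It holds for large `i` because `w - δ > d`.
  have hex : ∃ i, Real.log K + 2 * Real.log (height Q) + d * Real.log (height (P i)) <
      Real.log (height (P (i + 1))) := by
    obtain ⟨i, hi1, hi2⟩ := ((h.eventually_le_add (θ := w - δ) (by linarith) 0).and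
      (h.tendsto_log.eventually_gt_atTop
        ((Real.log K + 2 * Real.log (height Q)) / (w - d - δ)))).exists
    refine ⟨i, ?_⟩
    rw [div_lt_iff₀ hwd] at hi2
    linarith
  classical
  obtain ⟨i, hi, hmin⟩ : ∃ i, Real.log K + 2 * Real.log (height Q) +
      d * Real.log (height (P i)) < Real.log (height (P (i + 1))) ∧
      ∀ j < i, ¬ Real.log K + 2 * Real.log (height Q) +
        d * Real.log (height (P j)) < Real.log (height (P (j + 1))) :=
    ⟨Nat.find hex, Nat.find_spec hex, fun j hj => Nat.find_min hex hj⟩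
  have hsmall : ∀ j ≤ N, ¬ Real.log K + 2 * Real.log (height Q) +
        d * Real.log (height (P j)) < Real.log (height (P (j + 1))) := by
    intro j hj
    have h1 : Real.log (height (P (j + 1))) ≤ B₁ := hB₁ ⟨j, hj, rfl⟩
    have h2 : B₁ - Real.log K ≤ b := (le_max_left _ _).trans (le_max_right _ _)
    have h3 : 0 ≤ b := (le_max_right _ _).trans (le_max_right _ _)
    have h4 := mul_nonneg (Nat.cast_nonneg (α := ℝ) d) (hlogP j)
    linarith
  have hiN : N < i := by
    by_contra! hle
    exact hsmall i hle hi
  obtain ⟨j, rfl⟩ : ∃ j, i = j + 1 := ⟨i - 1, by omega⟩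
  obtain ⟨hj1, hj2⟩ := hN j (by omega)
  have hj3 := not_lt.1 (hmin j (Nat.lt_succ_self j))
  -- the value at `ξ` equals the value at the quadratic element
  have hliou := (h.pair (j + 1)).liouville hQ (hQP (j + 1)) hQd
  have hPpos := h.height_pos (j + 1)
  have hval0 : 0 < absV F (Q.eval₂ polyEmb (α (j + 1))) := by
    by_contra! hle
    have : absV F (Q.eval₂ polyEmb (α (j + 1))) = 0 :=
      le_antisymm hle (AbsoluteValue.nonneg _ _)
    rw [this, mul_zero] at hliou
    linarith
  have hlogval : -Real.log (height Q) - d * Real.log (height (P (j + 1))) ≤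
      Real.log (absV F (Q.eval₂ polyEmb (α (j + 1)))) := by
    have := Real.log_nonneg hliou
    rw [Real.log_mul (mul_pos (pow_pos hPpos _) hHQ0).ne' hval0.ne',
      Real.log_mul (pow_pos hPpos _).ne' hHQ0.ne', Real.log_pow] at this
    linarith
  have heq : absV F (Q.eval₂ polyEmb ξ) = absV F (Q.eval₂ polyEmb (α (j + 1))) := by
    rw [← sub_add_cancel (Q.eval₂ polyEmb ξ) (Q.eval₂ polyEmb (α (j + 1))), add_comm]
    refine absV_add_eq_of_lt
      ((absV_eval₂_sub_le Q h.absV_le (h.pair (j + 1)).absV_le).trans_lt ?_)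
    have h2 := (h.log_absV_sub (j + 1)).1
    rw [← Real.log_lt_log_iff (mul_pos hHQ0 h2) hval0, Real.log_mul hHQ0.ne' h2.ne',
      (h.log_absV_sub (j + 1)).2]
    linarith
  rw [heq, rpow_neg_le_iff hHQ0 hval0]
  -- Minimality fails the condition at `j`; combined with `H(Pⱼ₊₁) ≥ H(Pⱼ) ^ (w - δ)` this bounds
  -- `H(Pⱼ)` by a power of `H(Q)`.
  have hhj : Real.log (height (P j)) ≤
      (2 * Real.log (height Q) + |Real.log K|) / (w - d - δ) := by
    rw [le_div_iff₀ hwd]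
    have := le_abs_self (Real.log K)
    linarith
  have hw0 : 0 ≤ w + δ := by linarith [h.one_lt]
  have hfin : d * Real.log (height (P (j + 1))) ≤
      d * ((w + δ) * ((2 * Real.log (height Q) + |Real.log K|) / (w - d - δ))) := by
    refine mul_le_mul_of_nonneg_left ?_ (Nat.cast_nonneg d)
    have := mul_le_mul_of_nonneg_left hhj hw0
    linarith
  have hid : d * ((w + δ) * ((2 * Real.log (height Q) + |Real.log K|) / (w - d - δ))) =
      (θ - γ - 1) * Real.log (height Q) + k := by
    rw [hγ, hk]
    field_simp
    ring
  have hkb : k ≤ γ * Real.log (height Q) := by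
    have : k / γ ≤ Real.log (height Q) :=
      ((le_max_right _ _).trans (le_max_left _ _)).trans hlog
    rwa [div_le_iff₀' hγ0] at this
  linarith

end IsQuadApprox

end

/-! ### From lower bounds for irreducible polynomials to the exponents -/

section

variable {F : Type*} [Field F] [Finite F]

lemma sSup_coe_image_eq {S : Set ℝ} {w : ℝ} (h1 : ∀ x ∈ S, x ≤ w) (h2 : ∀ x < w, x ∈ S) :
    sSup ((fun x : ℝ => (x : EReal)) '' S) = (w : EReal) := by
  apply le_antisymm
  · refine sSup_le ?_
    rintro _ ⟨x, hx, rfl⟩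
    exact EReal.coe_le_coe_iff.2 (h1 x hx)
  · refine le_of_forall_lt fun y hy => ?_
    obtain ⟨x, hyx, hxw⟩ := EReal.lt_iff_exists_real_btwn.1 hy
    exact hyx.trans_le (le_sSup ⟨x, h2 x (EReal.coe_lt_coe_iff.1 hxw), rfl⟩)

lemma infinite_of_eventually_mem {β : Type*} {S : Set β} {x : ℕ → β} {f : β → ℝ}
    (hf : Tendsto (fun i => f (x i)) atTop atTop) (hx : ∀ᶠ i in atTop, x i ∈ S) : S.Infinite := by
  intro hfin
  obtain ⟨B, hB⟩ := (hfin.image f).bddAbove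
  obtain ⟨i, hi1, hi2⟩ := (hx.and (hf.eventually_gt_atTop B)).exists
  exact absurd (hB ⟨_, hi1, rfl⟩) (not_le.2 hi2)

lemma height_absV_eval₂_of_isUnit {Q : F[X][X]} (hQ : IsUnit Q) (ξ : LaurentSeries F) :
    height Q = 1 ∧ absV F (Q.eval₂ polyEmb ξ) = 1 := by
  obtain ⟨r, hr, rfl⟩ := isUnit_iff.1 hQ
  have : absV F (polyEmb r) = 1 := by
    rw [absV_polyEmb hr.ne_zero, natDegree_eq_zero_of_isUnit hr, pow_zero]
  rw [height_C, eval₂_C]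
  exact ⟨this, this⟩

lemma height_absV_eval₂_of_associated {P Q : F[X][X]} (h : Associated P Q) (ξ : LaurentSeries F) :
    height Q = height P ∧ absV F (Q.eval₂ polyEmb ξ) = absV F (P.eval₂ polyEmb ξ) := by
  obtain ⟨u, rfl⟩ := h
  obtain ⟨h1, h2⟩ := height_absV_eval₂_of_isUnit u.isUnit ξ
  rw [height_mul, eval₂_mul, map_mul, h1, h2, mul_one, mul_one]
  exact ⟨rfl, rfl⟩

/-- A lower bound for the values at `ξ` of irreducible polynomials yields one for all
polynomials. -/
lemma exists_pow_mul_rpow_le {ξ : LaurentSeries F} {d : ℕ} {θ B : ℝ} (hθ : 0 ≤ θ)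
    (hB : ∀ Q : F[X][X], Irreducible Q → Q.natDegree ≤ d → B ≤ height Q →
      height Q ^ (-θ) ≤ absV F (Q.eval₂ polyEmb ξ)) :
    ∃ c : ℝ, 0 < c ∧ ∀ Q : F[X][X], Q.natDegree ≤ d → 0 < absV F (Q.eval₂ polyEmb ξ) →
      c * height Q ^ (-θ) ≤ absV F (Q.eval₂ polyEmb ξ) := by
  have hrp : ∀ Q : F[X][X], Q ≠ 0 → 0 ≤ height Q ^ (-θ) ∧ height Q ^ (-θ) ≤ 1 := fun Q hQ =>
    ⟨Real.rpow_nonneg (zero_le_one.trans (one_le_height hQ)) _,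
      Real.rpow_le_one_of_one_le_of_nonpos (one_le_height hQ) (neg_nonpos.2 hθ)⟩
  obtain ⟨D, hD⟩ := ((finite_setOf_natDegree_le_height_le (F := F) d B).image
    fun Q => (absV F (Q.eval₂ polyEmb ξ))⁻¹).bddAbove
  -- `c` is at most 1 and at most every nonzero value at `ξ` of the finitely many polynomials of
  -- degree at most `d` and height at most `B`.
  set c := (max D 1)⁻¹ with hc
  have hc0 : 0 < c := inv_pos.2 (zero_lt_one.trans_le (le_max_right _ _))
  have hc1 : c ≤ 1 := inv_le_one_of_one_le₀ (le_max_right _ _)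
  have hirr : ∀ Q : F[X][X], Irreducible Q → Q.natDegree ≤ d → 0 < absV F (Q.eval₂ polyEmb ξ) →
      c ^ Q.natDegree * height Q ^ (-θ) ≤ absV F (Q.eval₂ polyEmb ξ) := by
    intro Q hQ hQd hQ0
    obtain ⟨hr0, hr1⟩ := hrp Q hQ.ne_zero
    -- Irreducible constants from `F[T]` must cost no factor `c`, since their number in a
    -- factorization is not bounded by the degree.
    rcases Nat.eq_zero_or_pos Q.natDegree with hdeg | hdeg
    · rw [hdeg, pow_zero, one_mul]
      refine hr1.trans ?_
      have hQC := eq_C_of_natDegree_eq_zero hdeg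
      have h0 := hQ.ne_zero
      rw [hQC] at h0 ⊢
      rw [eval₂_C]
      exact one_le_absV_polyEmb (by simpa using h0)
    · rcases le_total B (height Q) with h | h
      · exact (mul_le_of_le_one_left hr0 (pow_le_one₀ hc0.le hc1)).trans (hB Q hQ hQd h)
      · have h1 : (absV F (Q.eval₂ polyEmb ξ))⁻¹ ≤ D := hD ⟨Q, ⟨hQd, h⟩, rfl⟩
        have h2 : c ≤ absV F (Q.eval₂ polyEmb ξ) := by
          rw [hc]
          exact inv_le_of_inv_le₀ hQ0 (h1.trans (le_max_left _ _))
        calc c ^ Q.natDegree * height Q ^ (-θ) ≤ c ^ Q.natDegree * 1 := by gcongr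
          _ ≤ c := by rw [mul_one]; exact pow_le_of_le_one hc0.le hc1 hdeg.ne'
          _ ≤ _ := h2
  have hall : ∀ Q : F[X][X], Q.natDegree ≤ d → 0 < absV F (Q.eval₂ polyEmb ξ) →
      c ^ Q.natDegree * height Q ^ (-θ) ≤ absV F (Q.eval₂ polyEmb ξ) := by
    intro Q
    induction Q using WfDvdMonoid.induction_on_irreducible with
    | zero => intro _ h; simp at h
    | unit u hu =>
      intro _ _
      obtain ⟨h1, h2⟩ := height_absV_eval₂_of_isUnit hu ξ
      rw [h1, h2, Real.one_rpow, mul_one]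
      exact pow_le_one₀ hc0.le hc1
    | mul Q R hQ hR ih =>
      intro hdeg hpos
      rw [natDegree_mul hR.ne_zero hQ] at hdeg ⊢
      rw [eval₂_mul, map_mul] at hpos ⊢
      have hnn := fun Q : F[X][X] => AbsoluteValue.nonneg (absV F) (Q.eval₂ polyEmb ξ)
      have h1 := pos_of_mul_pos_left hpos (hnn Q)
      have h2 := pos_of_mul_pos_right hpos (hnn R)
      rw [height_mul, Real.mul_rpow (zero_le_one.trans (one_le_height hR.ne_zero))
        (zero_le_one.trans (one_le_height hQ)), pow_add, mul_mul_mul_comm]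
      exact mul_le_mul (hirr R hR (by omega) h1) (ih (by omega) h2)
        (mul_nonneg (pow_nonneg hc0.le _) (hrp Q hQ).1) h1.le
  refine ⟨c ^ d, pow_pos hc0 _, fun Q hQd hQ0 => ?_⟩
  have hQne : Q ≠ 0 := by rintro rfl; simp at hQ0
  exact (mul_le_mul_of_nonneg_right (pow_le_pow_of_le_one hc0.le hc1 hQd) (hrp Q hQne).1).trans
    (hall Q hQd hQ0)

namespace IsQuadApprox

variable {w : ℝ} {ξ : LaurentSeries F} {P : ℕ → F[X][X]} {α α' : ℕ → LaurentSeries F} {K K' : ℝ}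

theorem wExp_eq (h : IsQuadApprox w ξ P α α' K K') {d : ℕ} (hdw : (d : ℝ) < w)
    (hd : 1 + 2 * d * w / (w - d) ≤ w - 1) {n : ℕ} (hn : 2 ≤ n) (hnd : n ≤ d) :
    wExp n ξ = (w : EReal) := by
  refine sSup_coe_image_eq (fun w' hw' => ?_) fun w' hw' => ?_
  · by_contra! hlt
    set θ := (w + w') / 2 with hθ
    have hθw : w < θ := by linarith
    obtain ⟨B₁, hB₁⟩ := h.exists_rpow_le_absV_eval₂ hdw hd (θ := θ) (by linarith)
    obtain ⟨B₂, hB₂⟩ : ∃ B, ∀ i, B ≤ height (P i) →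
        height (P i) ^ (-θ) ≤ absV F ((P i).eval₂ polyEmb ξ) := by
      refine exists_bound_of_eventually ?_
      filter_upwards [h.eventually_absV_eval₂,
        h.eventually_add_le hθw (-(Real.log K + Real.log K'))] with i hi1 hi2
      rw [rpow_neg_le_iff (h.height_pos i) hi1.1, hi1.2]
      linarith
    obtain ⟨c, hc0, hc⟩ := exists_pow_mul_rpow_le (ξ := ξ) (d := d) (θ := θ) (B := max B₁ B₂)
      (by linarith [h.one_lt]) fun Q hQ hQd hBQ => by
        by_cases hass : ∃ i, Associated (P i) Q
        · obtain ⟨i, hi⟩ := hass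
          obtain ⟨h1, h2⟩ := height_absV_eval₂_of_associated hi ξ
          rw [h1] at hBQ ⊢
          rw [h2]
          exact hB₂ i ((le_max_right _ _).trans hBQ)
        · exact hB₁ Q hQ hQd (not_exists.1 hass) ((le_max_left _ _).trans hBQ)
    -- Since `w' > θ`, the inequalities `c H ^ (-θ) ≤ |Q(ξ)| ≤ H ^ (-w')` bound the height, leaving
    -- finitely many `Q`.
    refine hw' ((finite_setOf_natDegree_le_height_le n
      (Real.exp (-Real.log c / (w' - θ)))).subset ?_)
    rintro Q ⟨hQn, hQ0, hQ⟩
    refine ⟨hQn, ?_⟩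
    have hQ1 := hc Q (hQn.trans hnd) hQ0
    have hH : 0 < height Q :=
      zero_lt_one.trans_le (one_le_height (by rintro rfl; simp [absL] at hQ0))
    have hle := Real.log_le_log (mul_pos hc0 (Real.rpow_pos_of_pos hH _)) (hQ1.trans hQ)
    rw [Real.log_mul hc0.ne' (Real.rpow_pos_of_pos hH _).ne', Real.log_rpow hH,
      Real.log_rpow hH] at hle
    rw [← Real.log_le_iff_le_exp hH, le_div_iff₀ (by linarith)]
    linarith
  · refine infinite_of_eventually_mem (f := fun Q => Real.log (height Q)) h.tendsto_log ?_
    filter_upwards [h.eventually_absV_eval₂,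
      h.eventually_le_add hw' (-(Real.log K + Real.log K'))] with i hi1 hi2
    refine ⟨(h.pair i).natDegree_eq.trans_le hn, hi1.1, ?_⟩
    refine (le_rpow_neg_iff (h.height_pos i) hi1.1).2 ?_
    rw [hi1.2]
    linarith

theorem wStarExp_eq (h : IsQuadApprox w ξ P α α' K K') {d : ℕ} (hdw : (d : ℝ) < w)
    (hd : 1 + 2 * d * w / (w - d) ≤ w - 1) {n : ℕ} (hn : 2 ≤ n) (hnd : n ≤ d) :
    wStarExp n ξ = ((w - 1 : ℝ) : EReal) := by
  refine sSup_coe_image_eq (fun w' hw' => ?_) fun w' hw' => ?_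
  · by_contra! hlt
    set θ := (w - 1 + w') / 2 with hθ
    have hθw : w - 1 < θ := by linarith
    obtain ⟨B₁, hB₁⟩ := h.exists_rpow_le_absV_eval₂ hdw hd hθw
    obtain ⟨B₂, hB₂⟩ : ∃ B, ∀ i, B ≤ height (P i) →
        height (P i) ^ (-(θ + 1)) ≤ absV F (ξ - α i) ∧
        height (P i) ^ (-(θ + 1)) ≤ absV F (ξ - α' i) := by
      refine exists_bound_of_eventually ?_
      -- The last condition says `H(Pᵢ) ^ θ ≥ 1 / K'`, which is what the conjugate needs, as `|ξ -
      -- αᵢ'| = K' / H(Pᵢ)`.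
      filter_upwards [h.eventually_absV_sub',
        h.eventually_add_le (θ := θ + 1) (by linarith) (-Real.log K),
        h.tendsto_log.eventually_ge_atTop (-Real.log K' / θ)] with i hi1 hi2 hi3
      have hθ0 : 0 < θ := by linarith [h.one_lt]
      have hH := h.height_pos i
      have h1 : 0 < absV F (ξ - α' i) := pos_of_mul_pos_left (by rw [hi1]; exact h.pos') hH.le
      obtain ⟨h2, h3⟩ := h.log_absV_sub i
      rw [rpow_neg_le_iff hH h1, rpow_neg_le_iff hH h2, h3]
      refine ⟨by linarith, ?_⟩
      have h4 : Real.log K' = Real.log (absV F (ξ - α' i)) + Real.log (height (P i)) := by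
        rw [← hi1, Real.log_mul h1.ne' hH.ne']
      rw [div_le_iff₀' hθ0] at hi3
      linarith
    -- Finitely many polynomials, each with finitely many roots. The 1 in the maximum ensures `H(Q)
    -- > 1` outside this set, so that exponents can be compared.
    have hfin : {β : Closure F | ∃ Q : F[X][X], IsMinPoly Q β ∧ Q.natDegree ≤ n ∧
        height Q ≤ max B₁ (max B₂ 1)}.Finite := by
      refine ((finite_setOf_natDegree_le_height_le n (max B₁ (max B₂ 1))).biUnion
        (t := fun Q : F[X][X] =>
          {β | (Q.map ((algebraMap (LaurentSeries F) (Closure F)).comp polyEmb)).IsRoot β ∧ Q ≠ 0})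
        fun Q _ => ?_).subset ?_
      · by_cases hQ : Q = 0
        · simp [hQ]
        · refine (finite_setOfPred_isRoot (p := Q.map
            ((algebraMap (LaurentSeries F) (Closure F)).comp polyEmb)) ?_).subset fun β hβ => hβ.1
          have hinj : Function.Injective
              ((algebraMap (LaurentSeries F) (Closure F)).comp polyEmb) :=
            (algebraMap (LaurentSeries F) (Closure F)).injective.comp polyEmb_injective
          rwa [Ne, Polynomial.map_eq_zero_iff hinj]
      · rintro β ⟨Q, hQ, hQn, hQB⟩
        refine Set.mem_biUnion (show Q ∈ _ from ⟨hQn, hQB⟩) ⟨?_, hQ.irreducible.ne_zero⟩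
        rw [IsRoot, eval_map]
        exact hQ.root
    refine hw' (hfin.subset ?_)
    rintro β ⟨Q, hQ, hQn, hβ0, hβ⟩
    refine ⟨Q, hQ, hQn, ?_⟩
    by_contra! hB
    have hB1 : B₁ ≤ height Q := (le_max_left _ _).trans hB.le
    have hB2 : B₂ ≤ height Q := ((le_max_left _ _).trans (le_max_right _ _)).trans hB.le
    have hH1 : 1 < height Q := ((le_max_right _ _).trans (le_max_right _ _)).trans_lt hB
    have hH0 := zero_lt_one.trans hH1
    have key : height Q ^ (-(θ + 1)) ≤
        absC (algebraMap (LaurentSeries F) (Closure F) ξ - β) := by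
      by_cases hass : ∃ i, Associated (P i) Q
      · obtain ⟨i, hi⟩ := hass
        have h1 := (height_absV_eval₂_of_associated hi ξ).1
        rw [h1] at hB2 ⊢
        have hroot : (P i).eval₂ ((algebraMap (LaurentSeries F) (Closure F)).comp polyEmb) β = 0 := by
          obtain ⟨R, hR⟩ := hi.symm.dvd
          rw [hR, eval₂_mul, hQ.root, zero_mul]
        rcases (h.pair i).eq_or_eq_of_root hroot with rfl | rfl
        · rw [← map_sub, absC_algebraMap]
          exact (hB₂ i hB2).1
        · rw [← map_sub, absC_algebraMap]
          exact (hB₂ i hB2).2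
      · have h1 := (hB₁ Q hQ.irreducible (hQn.trans hnd) (not_exists.1 hass) hB1).trans
          (absV_eval₂_le_height_mul_absC h.absV_le hQ.root)
        rw [neg_add, Real.rpow_add hH0, Real.rpow_neg_one, mul_comm,
          inv_mul_le_iff₀ hH0]
        exact h1
    have := key.trans hβ
    rw [Real.rpow_le_rpow_left_iff hH1] at this
    linarith
  -- The `αᵢ` take infinitely many values because their distance to `ξ` tends to 0 without
  -- vanishing.
  · refine infinite_of_eventually_mem
      (x := fun i => algebraMap (LaurentSeries F) (Closure F) (α i))
      (f := fun β => -Real.log (absC (algebraMap (LaurentSeries F) (Closure F) ξ - β))) ?_ ?_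
    · have : ∀ i, -Real.log (absC (algebraMap (LaurentSeries F) (Closure F) ξ -
          algebraMap (LaurentSeries F) (Closure F) (α i))) =
          -Real.log K + Real.log (height (P (i + 1))) := by
        intro i
        rw [← map_sub, absC_algebraMap, (h.log_absV_sub i).2]
        ring
      simp only [this]
      exact tendsto_atTop_add_const_left _ _ ((tendsto_add_atTop_iff_nat 1).2 h.tendsto_log)
    · filter_upwards [h.eventually_le_add (θ := w' + 1) (by linarith) (-Real.log K)] with i hi
      obtain ⟨h1, h2⟩ := h.log_absV_sub i
      refine ⟨P i, (h.pair i).isMinPoly, (h.pair i).natDegree_eq.trans_le hn, ?_, ?_⟩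
      · rwa [← map_sub, absC_algebraMap]
      · rw [← map_sub, absC_algebraMap, show -w' - 1 = -(w' + 1) by ring,
          le_rpow_neg_iff (h.height_pos i) h1, h2]
        linarith

end IsQuadApprox

end

section

/-! ### The lacunary continued fraction -/

section Floor

variable {w : ℝ}

/-- `w ^ (i + 1) ≥ 3 w ^ i ≥ w ^ i + 2`. Hence the positions of `b` are distinct, with at least one
`a` between consecutive ones. -/
lemma floor_pow_add_two_le (hw : 3 ≤ w) (i : ℕ) : ⌊w ^ i⌋₊ + 2 ≤ ⌊w ^ (i + 1)⌋₊ := by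
  have h1 : 1 ≤ w ^ i := one_le_pow₀ (by linarith)
  rw [Nat.le_floor_iff (by positivity)]
  push_cast
  have := Nat.floor_le (zero_le_one.trans h1)
  rw [pow_succ]
  nlinarith

lemma strictMono_floor_pow (hw : 3 ≤ w) : StrictMono fun i : ℕ => ⌊w ^ i⌋₊ :=
  strictMono_nat_of_lt_succ fun i => by
    have := floor_pow_add_two_le hw i
    omega

lemma ne_floor_pow_of_mem_Ioo (hw : 3 ≤ w) {i j : ℕ} (h1 : ⌊w ^ i⌋₊ < j) (h2 : j < ⌊w ^ (i + 1)⌋₊)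
    (k : ℕ) : j ≠ ⌊w ^ k⌋₊ := by
  rintro rfl
  have h3 := (strictMono_floor_pow hw).lt_iff_lt.1 h1
  have h4 := (strictMono_floor_pow hw).lt_iff_lt.1 h2
  omega

lemma tendsto_floor_pow_div (hw : 1 < w) :
    Tendsto (fun i : ℕ => (⌊w ^ i⌋₊ : ℝ) / w ^ i) atTop (𝓝 1) :=
  (tendsto_nat_floor_div_atTop (R := ℝ)).comp (tendsto_pow_atTop_atTop_of_one_lt hw)

end Floor

variable {F : Type*} [Field F] {a b : F[X]} {w : ℝ}

lemma partialQuot_zero : partialQuot w a b 0 = 0 := by simp [partialQuot]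

lemma partialQuot_natDegree_pos (ha : 0 < a.natDegree) (hb : 0 < b.natDegree) (n : ℕ) :
    0 < (partialQuot w a b (n + 1)).natDegree := by
  simp only [partialQuot, Nat.succ_ne_zero, if_false]
  split_ifs
  exacts [hb, ha]

lemma partialQuot_floor_pow (hw : 3 ≤ w) (i : ℕ) : partialQuot w a b ⌊w ^ i⌋₊ = b := by
  have : ⌊w ^ i⌋₊ ≠ 0 := by
    rw [Ne, Nat.floor_eq_zero, not_lt]
    exact one_le_pow₀ (by linarith)
  rw [partialQuot, if_neg this, if_pos ⟨i, rfl⟩]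

lemma partialQuot_of_mem_Ioo (hw : 3 ≤ w) {i j : ℕ} (h1 : ⌊w ^ i⌋₊ < j)
    (h2 : j < ⌊w ^ (i + 1)⌋₊) : partialQuot w a b j = a := by
  rw [partialQuot, if_neg (by omega), if_neg]
  rintro ⟨k, hk⟩
  exact ne_floor_pow_of_mem_Ioo hw h1 h2 k hk

variable [Finite F]

/-- `|q n|` is the product of the absolute values of the first `n` partial quotients, of which
exactly `i + 1` equal `b` when `n` is the integer part of `w ^ i`. -/
lemma log_absV_cfDen_floor_pow (ha : 0 < a.natDegree) (hb : 0 < b.natDegree) (hw : 3 ≤ w) (i : ℕ) :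
    Real.log (absV F (polyEmb (cfDen (partialQuot w a b) ⌊w ^ i⌋₊))) =
      ⌊w ^ i⌋₊ * Real.log (absV F (polyEmb a)) +
        (i + 1) * (Real.log (absV F (polyEmb b)) - Real.log (absV F (polyEmb a))) := by
  have hs := partialQuot_natDegree_pos (w := w) ha hb
  have hstep : ∀ n, Real.log (absV F (polyEmb (cfDen (partialQuot w a b) (n + 1)))) =
      Real.log (absV F (polyEmb (partialQuot w a b (n + 1)))) +
        Real.log (absV F (polyEmb (cfDen (partialQuot w a b) n))) := by
    intro n
    rw [(absV_cfDen_succ hs n).1, Real.log_mul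
      (zero_lt_one.trans (one_lt_absV_polyEmb (hs n))).ne' (absV_cfDen_pos hs n).ne']
  induction i with
  | zero =>
    have hb1 := partialQuot_floor_pow (a := a) (b := b) hw 0
    simp only [pow_zero, Nat.floor_one] at hb1 ⊢
    rw [show (1 : ℕ) = 0 + 1 from rfl, hstep, hb1]
    simp [cfDen]
  | succ i ih =>
    have hmid : ∀ m : ℕ, ⌊w ^ i⌋₊ + m < ⌊w ^ (i + 1)⌋₊ →
        Real.log (absV F (polyEmb (cfDen (partialQuot w a b) (⌊w ^ i⌋₊ + m)))) =
          Real.log (absV F (polyEmb (cfDen (partialQuot w a b) ⌊w ^ i⌋₊))) +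
            m * Real.log (absV F (polyEmb a)) := by
      intro m
      induction m with
      | zero => intro _; simp
      | succ m ihm =>
        intro hm
        rw [← add_assoc, hstep, ihm (by omega), partialQuot_of_mem_Ioo hw (i := i) (by omega) (by omega)]
        push_cast
        ring
    obtain ⟨m, hm⟩ := Nat.exists_eq_add_of_le (floor_pow_add_two_le hw i)
    have hm' : ⌊w ^ (i + 1)⌋₊ = ⌊w ^ i⌋₊ + (m + 1) + 1 := by omega
    have hbi := partialQuot_floor_pow (a := a) (b := b) hw (i + 1)
    rw [hm'] at hbi ⊢
    rw [hstep, hbi, hmid (m + 1) (by omega), ih]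
    push_cast
    ring

/-- The quadratic approximations of the lacunary continued fraction. -/
lemma exists_isQuadApprox (ha : 0 < a.natDegree) (hb : 0 < b.natDegree) (hab : a ≠ b) (hw : 3 ≤ w)
    {ξ : LaurentSeries F} (hξ : HasContFrac (partialQuot w a b) ξ) :
    ∃ P α α' K K', IsQuadApprox w ξ P α α' K K' := by
  have hs := partialQuot_natDegree_pos (w := w) ha hb
  have hw1 : 1 < w := by linarith
  have ha1 := one_lt_absV_polyEmb ha
  have hb1 := one_lt_absV_polyEmb hb
  have ha0 := zero_lt_one.trans ha1
  have hb0 := zero_lt_one.trans hb1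
  have hab0 : 0 < absV F (polyEmb (a - b)) :=
    zero_lt_one.trans_le (one_le_absV_polyEmb (sub_ne_zero.2 hab))
  have hex : ∀ i : ℕ, ∃ (P : F[X][X]) (α α' : LaurentSeries F), IsQuadPair P α α' ∧
      height P * absV F (polyEmb b) =
        absV F (polyEmb (cfDen (partialQuot w a b) ⌊w ^ i⌋₊)) ^ 2 * absV F (polyEmb (a - b)) ∧
      absV F (α - α') * height P = absV F (polyEmb a) ∧
      absV F (ξ - α) * (absV F (polyEmb a) *
        absV F (polyEmb (cfDen (partialQuot w a b) ⌊w ^ (i + 1)⌋₊)) ^ 2) =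
        absV F (polyEmb (a - b)) * absV F (polyEmb b) := by
    intro i
    have h1 : 1 ≤ ⌊w ^ i⌋₊ := Nat.le_floor (by simpa using one_le_pow₀ hw1.le)
    have h2 := floor_pow_add_two_le hw i
    have hbi := partialQuot_floor_pow (a := a) (b := b) hw i
    have hbi' := partialQuot_floor_pow (a := a) (b := b) hw (i + 1)
    have hmid := fun j => partialQuot_of_mem_Ioo (a := a) (b := b) hw (i := i) (j := j)
    obtain ⟨k, hk⟩ := Nat.exists_eq_add_of_le' h1
    obtain ⟨M, hM⟩ := Nat.exists_eq_add_of_le' (show 2 ≤ ⌊w ^ (i + 1)⌋₊ by omega)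
    rw [hk] at hbi h2 hmid
    rw [hM] at hbi' h2 hmid
    have := exists_isQuadPair ha partialQuot_zero hs hξ (k := k) (M := M) (by omega)
      (by rw [hbi]; exact hab.symm) (by rw [hbi']; exact hab.symm) hmid
    rwa [hbi, hbi', ← hk, ← hM] at this
  choose P α α' hpair hheight hconj hdist using hex
  have hqpos := fun i : ℕ => absV_cfDen_pos hs ⌊w ^ i⌋₊
  have hHpos : ∀ i, 0 < height (P i) := fun i => zero_lt_one.trans_le (hpair i).one_le_height
  have hlog : ∀ i : ℕ, Real.log (height (P i)) =
      2 * (⌊w ^ i⌋₊ * Real.log (absV F (polyEmb a)) +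
        (i + 1) * (Real.log (absV F (polyEmb b)) - Real.log (absV F (polyEmb a)))) +
      (Real.log (absV F (polyEmb (a - b))) - Real.log (absV F (polyEmb b))) := by
    intro i
    have h1 := congrArg Real.log (hheight i)
    rw [Real.log_mul (hHpos i).ne' hb0.ne', Real.log_mul (pow_pos (hqpos i) 2).ne' hab0.ne',
      Real.log_pow, log_absV_cfDen_floor_pow ha hb hw] at h1
    push_cast at h1
    linarith
  have hpow : Tendsto (fun i : ℕ => w ^ i) atTop atTop := tendsto_pow_atTop_atTop_of_one_lt hw1
  -- The entries `b` contribute only `O(i)` to the logarithm of the height, negligible against `w ^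
  -- i`.
  have hlim : Tendsto (fun i => Real.log (height (P i)) / w ^ i) atTop
      (𝓝 (2 * Real.log (absV F (polyEmb a)))) := by
    have hlin : Tendsto (fun i : ℕ => (i : ℝ) / w ^ i) atTop (𝓝 0) := by
      simpa using tendsto_pow_const_div_const_pow_of_one_lt 1 hw1
    have h1 := (((tendsto_floor_pow_div hw1).mul_const (Real.log (absV F (polyEmb a)))).add
      ((hlin.add (hpow.const_div_atTop 1)).mul_const
        (Real.log (absV F (polyEmb b)) - Real.log (absV F (polyEmb a))))).const_mul 2
    have h2 := h1.add (hpow.const_div_atTop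
      (Real.log (absV F (polyEmb (a - b))) - Real.log (absV F (polyEmb b))))
    simp only [add_zero, zero_mul, one_mul] at h2
    refine h2.congr fun i => ?_
    have : w ^ i ≠ 0 := by positivity
    rw [hlog]
    field_simp
  have hla : 0 < 2 * Real.log (absV F (polyEmb a)) := mul_pos two_pos (Real.log_pos ha1)
  -- The constant `K = |a - b|² / |a|` comes from multiplying the distance formula for `αᵢ` by the
  -- height formula for `Pᵢ₊₁`: both involve the same denominator squared, which cancels.
  refine ⟨P, α, α', absV F (polyEmb (a - b)) ^ 2 / absV F (polyEmb a), absV F (polyEmb a),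
    hξ.absV_le_one partialQuot_zero hs, hw1, hpair, by positivity, ha0, fun i => ?_, hconj, ?_, ?_⟩
  · have h1 := hdist i
    have h2 := hheight (i + 1)
    rw [eq_div_iff ha0.ne']
    refine mul_right_cancel₀ (mul_pos hb0 (pow_pos (hqpos (i + 1)) 2)).ne' ?_
    calc _ = absV F (ξ - α i) * (absV F (polyEmb a) *
          absV F (polyEmb (cfDen (partialQuot w a b) ⌊w ^ (i + 1)⌋₊)) ^ 2) *
          (height (P (i + 1)) * absV F (polyEmb b)) := by ring
      _ = _ := by rw [h1, h2]; ring
  · refine (hlim.pos_mul_atTop hla hpow).congr fun i => ?_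
    exact div_mul_cancel₀ _ (by positivity)
  · have h1 := (((tendsto_add_atTop_iff_nat 1).2 hlim).div hlim hla.ne').mul_const w
    rw [div_self hla.ne', one_mul] at h1
    refine h1.congr fun i => ?_
    have h2 : w ^ i ≠ 0 := by positivity
    simp only [Pi.div_apply]
    rw [pow_succ]
    field_simp

end

end LaurentApprox

end

/-! ### Conclusion: the condition on `w` -/

theorem mainTheorem2 {F : Type*} [Field F] [Finite F] (d : ℕ) (hd : 2 ≤ d) (w : ℝ)
    (hw : (3 * (d : ℝ) + 2 + √(9 * (d : ℝ) ^ 2 + 4 * (d : ℝ) + 4)) / 2 ≤ w)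
    (a b : Polynomial F) (ha : 0 < a.natDegree) (hb : 0 < b.natDegree) (hab : a ≠ b) :
    (∃! ξ : LaurentSeries F, LaurentApprox.HasContFrac (LaurentApprox.partialQuot w a b) ξ) ∧
      ∀ ξ : LaurentSeries F, LaurentApprox.HasContFrac (LaurentApprox.partialQuot w a b) ξ →
        ∀ n : ℕ, 2 ≤ n → n ≤ d →
          LaurentApprox.wStarExp n ξ = ((w - 1 : ℝ) : EReal) ∧
          LaurentApprox.wExp n ξ = (w : EReal) := by
  have hd2 : (2 : ℝ) ≤ d := by exact_mod_cast hd
  set r := √(9 * (d : ℝ) ^ 2 + 4 * (d : ℝ) + 4) with hr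
  have hr0 : 0 ≤ r := Real.sqrt_nonneg _
  have hr2 : r ^ 2 = 9 * (d : ℝ) ^ 2 + 4 * (d : ℝ) + 4 := Real.sq_sqrt (by positivity)
  have hrle : r ≤ 2 * w - (3 * d + 2) := by linarith
  -- The bound on `w` is the larger root of this quadratic, whose nonnegativity is `2dw ≤ (w - 2)(w
  -- - d)`, that is, `hcond` below.
  have hquad : 0 ≤ w ^ 2 - (3 * d + 2) * w + 2 * d := by
    have := pow_le_pow_left₀ hr0 hrle 2
    rw [hr2] at this
    linarith
  have hdw : (d : ℝ) < w := by linarith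
  have hcond : 1 + 2 * d * w / (w - d) ≤ w - 1 := by
    rw [← le_sub_iff_add_le', div_le_iff₀ (by linarith)]
    linarith
  obtain ⟨ξ₀, hξ₀⟩ := LaurentApprox.exists_hasContFrac
    (LaurentApprox.partialQuot_natDegree_pos (w := w) ha hb)
  refine ⟨⟨ξ₀, hξ₀, fun ξ hξ => hξ.unique hξ₀⟩, fun ξ hξ n hn hnd => ?_⟩
  obtain ⟨P, α, α', K, K', h⟩ :=
    LaurentApprox.exists_isQuadApprox ha hb hab (by linarith) hξ
  exact ⟨h.wStarExp_eq hdw hcond hn hnd, h.wExp_eq hdw hcond hn hnd⟩
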